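/- Work either in the real smooth category ($\mathbb K=\mathbb R$) or in the complex holomorphic category ($\mathbb K=\mathbb C$). Let $U\subset\mathbb K$ be a non-empty connected open set, let $a,b,c,p,q,r$ be smooth (holomorphic) functions on $U$, and consider the equation $$(a(u))_{xx}+(b(u))_{yy}+(c(u))_{tt}+2(p(u))_{xy}+2(q(u))_{xt}+2(r(u))_{yt}=0\qquad(*)$$ for a function $u(x,y,t)$ with values in $U$. Put $$V(u)=\begin{pmatrix}a'&p'&q'\\ p'&b'&r'\\ q'&r'&c'\end{pmatrix}$$ and assume $\det V(u)\neq0$ for all $u\in U$. Let $g=g_{ij}(u)\,dx^idx^j$, $(g_{ij})=V^{-1}$, $(x^1,x^2,x^3)=(x,y,t)$. Call $(*)$ linearizable if, locally near every value $u_0\in U$, an invertible linear change of $(x,y,t)$ together with a local diffeomorphic (biholomorphic) change $u=\varphi(w)$ of the dependent variable transforms $(*)$ into a linear equation for $w$. Call $g$ conformally flat on every solution if its Cotton tensor $\nabla_r(R_{pq}-\frac14Rg_{pq})-\nabla_q(R_{pr}-\frac14Rg_{pr})$ vanishes modulo $(*)$ and its differential consequences, i.e. at every $3$-jet of a function $u$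 (with value in $U$) satisfying $(*)$ and the first total derivatives of $(*)$ in $x,y,t$. Then $(*)$ is linearizable if and only if $g$ is conformally flat on every solution. Equivalently, $V$ is constant up to a scalar factor: there are a constant matrix $V_0$ and a scalar function $f$ with $V(u)=f(u)V_0$ on $U$. In particular, if $(*)$ is normalized by $c(u)=u$, then $g$ is conformally flat on every solution if and only if $V$ is constant. -/

import Mathlib

open scoped ContDiff

noncomputable section

namespace TypeIEquation

/-- The space of the independent variables `(x, y, t) = (x⁰, x¹, x²)`. -/
abbrev Space (𝕜 : Type*) := Fin 3 → 𝕜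

/-- The partial derivative `∂f/∂xⁱ` of a scalar function of `(x, y, t)`. -/
def pd {𝕜 : Type*} [RCLike 𝕜] (i : Fin 3) (f : Space 𝕜 → 𝕜) (x : Space 𝕜) : 𝕜 :=
  fderiv 𝕜 f x (Pi.single i 1)

/-! ### The Cotton tensor of a metric on a domain of three-space

A metric (real of any signature, or complex holomorphic) is given by its matrix
`g x = (g_{ij}(x))`; the inverse metric `g^{ij}` is the inverse matrix. -/

section Cotton

variable {𝕜 : Type*} [RCLike 𝕜] (g : Space 𝕜 → Matrix (Fin 3) (Fin 3) 𝕜)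

/-- Christoffel symbols of the Levi-Civita connection:
`Γ^k_{ij} = ½ g^{kl} (∂_i g_{jl} + ∂_j g_{il} - ∂_l g_{ij})`. -/
def christoffel (k i j : Fin 3) (x : Space 𝕜) : 𝕜 :=
  (1 / 2) * ∑ l, (g x)⁻¹ k l *
    (pd i (fun y => g y j l) x + pd j (fun y => g y i l) x - pd l (fun y => g y i j) x)

/-- The Ricci tensor
`R_{ij} = ∂_k Γ^k_{ij} - ∂_j Γ^k_{ik} + Γ^k_{kl} Γ^l_{ij} - Γ^k_{jl} Γ^l_{ik}`. -/
def ricci (i j : Fin 3) (x : Space 𝕜) : 𝕜 :=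
  (∑ k, (pd k (christoffel g k i j) x - pd j (christoffel g k i k) x)) +
    ∑ k, ∑ l, (christoffel g k k l x * christoffel g l i j x -
      christoffel g k j l x * christoffel g l i k x)

/-- The scalar curvature `R = g^{ij} R_{ij}`. -/
def scalarCurvature (x : Space 𝕜) : 𝕜 :=
  ∑ i, ∑ j, (g x)⁻¹ i j * ricci g i j x

/-- The tensor `P_{ij} = R_{ij} - ¼ R g_{ij}` (the Schouten tensor in dimension three). -/
def schouten (i j : Fin 3) (x : Space 𝕜) : 𝕜 :=
  ricci g i j x - (1 / 4) * scalarCurvature g x * g x i j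

/-- The covariant derivative `∇_r P_{ij} = ∂_r P_{ij} - Γ^s_{ri} P_{sj} - Γ^s_{rj} P_{is}`. -/
def covSchouten (r i j : Fin 3) (x : Space 𝕜) : 𝕜 :=
  pd r (schouten g i j) x - ∑ s, (christoffel g s r i x * schouten g s j x +
    christoffel g s r j x * schouten g i s x)

/-- The Cotton tensor `∇_r P_{pq} - ∇_q P_{pr}`. -/
def cotton (p q r : Fin 3) (x : Space 𝕜) : 𝕜 :=
  covSchouten g r p q x - covSchouten g q p r x

end Cotton

/-! ### Type I equations -/

/-- The six coefficient functions of a type I equation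
`(a(u))_xx + (b(u))_yy + (c(u))_tt + 2 (p(u))_xy + 2 (q(u))_xt + 2 (r(u))_yt = 0`. -/
structure Coeffs (𝕜 : Type*) where
  /-- the coefficient under `∂_x ∂_x` -/
  a : 𝕜 → 𝕜
  /-- the coefficient under `∂_y ∂_y` -/
  b : 𝕜 → 𝕜
  /-- the coefficient under `∂_t ∂_t` -/
  c : 𝕜 → 𝕜
  /-- the coefficient under `2 ∂_x ∂_y` -/
  p : 𝕜 → 𝕜
  /-- the coefficient under `2 ∂_x ∂_t` -/
  q : 𝕜 → 𝕜
  /-- the coefficient under `2 ∂_y ∂_t` -/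
  r : 𝕜 → 𝕜

namespace Coeffs

variable {𝕜 : Type*} [RCLike 𝕜] (E : Coeffs 𝕜)

/-- All coefficients are smooth on `U` (that is, holomorphic when `𝕜 = ℂ` and `U` is open). -/
def SmoothOn (U : Set 𝕜) : Prop :=
  ContDiffOn 𝕜 ∞ E.a U ∧ ContDiffOn 𝕜 ∞ E.b U ∧ ContDiffOn 𝕜 ∞ E.c U ∧
    ContDiffOn 𝕜 ∞ E.p U ∧ ContDiffOn 𝕜 ∞ E.q U ∧ ContDiffOn 𝕜 ∞ E.r U

/-- The left-hand side of the equation, evaluated on a function `u(x, y, t)`. -/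
def lhs (u : Space 𝕜 → 𝕜) (x : Space 𝕜) : 𝕜 :=
  pd 0 (pd 0 fun z => E.a (u z)) x + pd 1 (pd 1 fun z => E.b (u z)) x +
    pd 2 (pd 2 fun z => E.c (u z)) x + 2 * pd 0 (pd 1 fun z => E.p (u z)) x +
    2 * pd 0 (pd 2 fun z => E.q (u z)) x + 2 * pd 1 (pd 2 fun z => E.r (u z)) x

/-- The symmetric matrix `V(u)`, the symbol of the formal linearization. -/
def V (s : 𝕜) : Matrix (Fin 3) (Fin 3) 𝕜 :=
  !![deriv E.a s, deriv E.p s, deriv E.q s;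
     deriv E.p s, deriv E.b s, deriv E.r s;
     deriv E.q s, deriv E.r s, deriv E.c s]

/-- The metric `g = V(u)⁻¹` carried by a function `u(x, y, t)`. -/
def metric (u : Space 𝕜 → 𝕜) (x : Space 𝕜) : Matrix (Fin 3) (Fin 3) 𝕜 :=
  (E.V (u x))⁻¹

/-- `g = V(u)⁻¹` is conformally flat on every solution: its Cotton tensor, a function of the
`3`-jet of `u`, vanishes modulo the equation and its differential consequences. That is, it
vanishes on all `3`-jets, with the value of `u` in `U`, that satisfy the equation together with
its first total derivatives (which are all its consequences of order at most three). Jets at `x`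
are represented by functions that are smooth near `x`. -/
def ConformallyFlatOnSolutions (U : Set 𝕜) : Prop :=
  ∀ (u : Space 𝕜 → 𝕜) (x : Space 𝕜), ContDiffAt 𝕜 ∞ u x → u x ∈ U →
    E.lhs u x = 0 → (∀ k, pd k (E.lhs u) x = 0) →
      ∀ i j k, cotton (E.metric u) i j k x = 0

/-- Linearizability of the equation, locally near every value `u₀ ∈ U` of the dependent variable,
by an invertible linear change `A` of `(x, y, t)` and a local change `u = φ(w)` of the dependent
variable (a local diffeomorphism, biholomorphic when `𝕜 = ℂ`): for `u(x) = φ(w(A x))`, the equation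
for `u` is equivalent to a linear second order equation
`∑ L_{ij} w_{ij} + ∑ l_i w_i + l₀ w + m = 0` for `w`. The coefficients `L, l, l₀, m` may be
arbitrary functions of the independent variables. -/
def Linearizable (U : Set 𝕜) : Prop :=
  ∀ u₀ ∈ U, ∃ (A : Space 𝕜 ≃L[𝕜] Space 𝕜) (φ : OpenPartialHomeomorph 𝕜 𝕜),
    u₀ ∈ φ.target ∧ φ.target ⊆ U ∧
    ContDiffOn 𝕜 ∞ φ φ.source ∧ ContDiffOn 𝕜 ∞ φ.symm φ.target ∧
    ∃ (L : Space 𝕜 → Matrix (Fin 3) (Fin 3) 𝕜) (l : Space 𝕜 → Fin 3 → 𝕜) (l₀ m : Space 𝕜 → 𝕜),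
      ∀ (w : Space 𝕜 → 𝕜) (x : Space 𝕜), ContDiffAt 𝕜 ∞ w (A x) → w (A x) ∈ φ.source →
        (E.lhs (fun z => φ (w (A z))) x = 0 ↔
          (∑ i, ∑ j, L (A x) i j * pd i (pd j w) (A x)) + (∑ i, l (A x) i * pd i w (A x)) +
            l₀ (A x) * w (A x) + m (A x) = 0)

end Coeffs

end TypeIEquation

end

/-!
The metric `g = V(u)⁻¹` depends on the solution only through its values, so the Cotton tensor is a
polynomial in the derivatives of `u` of order at most three. Flatness and linearizability
are both compared with the proportionality of the values of `V`.

*Flatness forces proportionality.* It suffices to look at the solution jets `u = s + q` with `q` a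
cubic form at the origin: the equation and its first derivatives then only say that `q` is harmonic
for the constant symbol `V s`, and the Cotton tensor of `g` at the origin reduces to the linearized
Cotton tensor of `G + q H`, where `G = (V s)⁻¹` and `H` is the derivative of `V⁻¹` at `s`
(`cotton_eq_linSchouten`). For `q` take the harmonic part of the cube of a covector `α`; the Cotton
tensor contracted with `V α` is then `|α|²` times a nonzero multiple of `H V α ∧ α`
(`wedge_eq_zero_of_linCotton_eq_zero`). Hence `H V` is a scalar matrix
(`isScalar_of_wedge_eq_zero`), which means that `V'` is a multiple of `V`, and the quotients of
entries of `V` are locally constant. Connectedness of `U` makes the proportionality global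
(`exists_eq_smul_of_locally_proportional`).

*Proportionality forces flatness.* If `V = f V₀`, then `g` is a conformal multiple of the constant
metric `V₀⁻¹`, and the Cotton tensor of such a metric vanishes (`cotton_conformal`), whether or not
`u` solves the equation.

*Proportionality and linearizability.* If `V = f V₀`, an antiderivative `w = F(u)` of `f` turns the
equation into `∑ (V₀)_{ij} w_{ij} = 0`. Conversely, suppose that `u = φ(w(A x))` makes the equation
linear, and test it on functions `w` that have a critical point, with value `c` and prescribed
Hessian. At the critical point the equation says that the Hessian is annihilated by `V(φ c)`, while
in the linear equation the value `c` enters only through an additive constant, which vanishes as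
the constant functions `w = c` are solutions. So the annihilator of `V(φ c)` does not depend on
`c`, and all these matrices are proportional (`proportional_of_annihilator`).

Smoothness of a germ at a point does not provide one neighbourhood on which all derivatives exist,
so identities between derivatives are stated as equalities of germs.
-/

noncomputable section

open Filter Topology

namespace TypeIEquation

/-! ### Partial derivatives -/

section Calculus

variable {𝕜 : Type*} [RCLike 𝕜] {f g : Space 𝕜 → 𝕜} {x : Space 𝕜}

theorem eventually_differentiableAt (hf : ContDiffAt 𝕜 ∞ f x) :
    ∀ᶠ y in 𝓝 x, DifferentiableAt 𝕜 f y := by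
  have h1 : ContDiffAt 𝕜 1 f x := hf.of_le (by exact_mod_cast le_top)
  filter_upwards [h1.eventually (by simp)] with y hy
  exact hy.differentiableAt (by simp)

theorem contDiffAt_pd (hf : ContDiffAt 𝕜 ∞ f x) (i : Fin 3) : ContDiffAt 𝕜 ∞ (pd i f) x := by
  have : ContDiffAt 𝕜 ∞ (fderiv 𝕜 f) x := hf.fderiv_right (by simp)
  exact this.clm_apply contDiffAt_const

theorem pd_congr (h : f =ᶠ[𝓝 x] g) (i : Fin 3) : pd i f x = pd i g x := by
  simp only [pd, h.fderiv_eq]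

theorem pd_eventuallyEq (h : f =ᶠ[𝓝 x] g) (i : Fin 3) : pd i f =ᶠ[𝓝 x] pd i g := by
  filter_upwards [h.eventuallyEq_nhds] with y hy
  exact pd_congr hy i

theorem pd_const (c : 𝕜) (i : Fin 3) : pd i (fun _ : Space 𝕜 => c) = fun _ => 0 := by
  ext y; simp [pd]

theorem pd_add (hf : DifferentiableAt 𝕜 f x) (hg : DifferentiableAt 𝕜 g x) (i : Fin 3) :
    pd i (fun y => f y + g y) x = pd i f x + pd i g x := by
  simp only [pd, fderiv_fun_add hf hg]; rfl

theorem pd_sub (hf : DifferentiableAt 𝕜 f x) (hg : DifferentiableAt 𝕜 g x) (i : Fin 3) :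
    pd i (fun y => f y - g y) x = pd i f x - pd i g x := by
  simp only [pd, fderiv_fun_sub hf hg]; rfl

theorem pd_mul (hf : DifferentiableAt 𝕜 f x) (hg : DifferentiableAt 𝕜 g x) (i : Fin 3) :
    pd i (fun y => f y * g y) x = pd i f x * g x + f x * pd i g x := by
  simp only [pd, fderiv_fun_mul hf hg]
  simp; ring

theorem pd_const_mul (hf : DifferentiableAt 𝕜 f x) (c : 𝕜) (i : Fin 3) :
    pd i (fun y => c * f y) x = c * pd i f x := by
  rw [pd_mul (differentiableAt_const c) hf, pd_const]; simp

theorem pd_sum {ι : Type*} (s : Finset ι) {F : ι → Space 𝕜 → 𝕜}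
    (hF : ∀ k ∈ s, DifferentiableAt 𝕜 (F k) x) (i : Fin 3) :
    pd i (fun y => ∑ k ∈ s, F k y) x = ∑ k ∈ s, pd i (F k) x := by
  simp only [pd, fderiv_fun_sum hF]
  simp

theorem pd_comp {F : 𝕜 → 𝕜} {u : Space 𝕜 → 𝕜} (hF : DifferentiableAt 𝕜 F (u x))
    (hu : DifferentiableAt 𝕜 u x) (i : Fin 3) :
    pd i (fun y => F (u y)) x = deriv F (u x) * pd i u x := by
  have h := hF.hasDerivAt.comp_hasFDerivAt x hu.hasFDerivAt
  have h2 : fderiv 𝕜 (fun y => F (u y)) x = _ := h.fderiv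
  simp only [pd, h2]
  simp

theorem pd_coord (i j : Fin 3) :
    pd i (fun y : Space 𝕜 => y j) = fun _ => if i = j then 1 else 0 := by
  ext y
  have h : HasFDerivAt (fun y : Space 𝕜 => y j) (ContinuousLinearMap.proj (R := 𝕜) j) y :=
    (ContinuousLinearMap.proj (R := 𝕜) (φ := fun _ : Fin 3 => 𝕜) j).hasFDerivAt
  simp only [pd, h.fderiv]
  simp [Pi.single_apply, eq_comm]

theorem pd_comm (h2 : ContDiffAt 𝕜 2 f x) (i j : Fin 3) :
    pd i (pd j f) x = pd j (pd i f) x := by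
  have hs : IsSymmSndFDerivAt 𝕜 f x := h2.isSymmSndFDerivAt (by simp)
  have hd : DifferentiableAt 𝕜 (fderiv 𝕜 f) x :=
    (h2.fderiv_right (m := 1) (by norm_num)).differentiableAt (by simp)
  have key : ∀ a b : Fin 3, pd a (pd b f) x
      = fderiv 𝕜 (fderiv 𝕜 f) x (Pi.single a 1) (Pi.single b 1) := by
    intro a b
    have : HasFDerivAt (fun y => fderiv 𝕜 f y (Pi.single b 1)) _ x :=
      hd.hasFDerivAt.clm_apply (hasFDerivAt_const _ x)
    have h3 : fderiv 𝕜 (pd b f) x = _ := this.fderiv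
    rw [pd, h3]
    simp
  rw [key, key, hs.eq]

theorem pd_comm_eventually (hf : ContDiffAt 𝕜 ∞ f x) (i j : Fin 3) :
    pd i (pd j f) =ᶠ[𝓝 x] pd j (pd i f) := by
  have h2 : ContDiffAt 𝕜 2 f x := contDiffAt_infty.1 hf 2
  filter_upwards [h2.eventually (by simp)] with y hy
  exact pd_comm hy i j

theorem _root_.ContDiffAt.differentiableAt_of_infty (hf : ContDiffAt 𝕜 ∞ f x) :
    DifferentiableAt 𝕜 f x := hf.differentiableAt (by simp)

theorem pd_add_eventually (hf : ContDiffAt 𝕜 ∞ f x) (hg : ContDiffAt 𝕜 ∞ g x) (i : Fin 3) :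
    pd i (fun y => f y + g y) =ᶠ[𝓝 x] fun y => pd i f y + pd i g y := by
  filter_upwards [eventually_differentiableAt hf, eventually_differentiableAt hg] with y h1 h2
  exact pd_add h1 h2 i

theorem pd_sub_eventually (hf : ContDiffAt 𝕜 ∞ f x) (hg : ContDiffAt 𝕜 ∞ g x) (i : Fin 3) :
    pd i (fun y => f y - g y) =ᶠ[𝓝 x] fun y => pd i f y - pd i g y := by
  filter_upwards [eventually_differentiableAt hf, eventually_differentiableAt hg] with y h1 h2
  exact pd_sub h1 h2 i

theorem pd_mul_eventually (hf : ContDiffAt 𝕜 ∞ f x) (hg : ContDiffAt 𝕜 ∞ g x) (i : Fin 3) :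
    pd i (fun y => f y * g y) =ᶠ[𝓝 x] fun y => pd i f y * g y + f y * pd i g y := by
  filter_upwards [eventually_differentiableAt hf, eventually_differentiableAt hg] with y h1 h2
  exact pd_mul h1 h2 i

theorem pd_comp_eventually {F : 𝕜 → 𝕜} {u : Space 𝕜 → 𝕜} (hF : ContDiffAt 𝕜 ∞ F (u x))
    (hu : ContDiffAt 𝕜 ∞ u x) (i : Fin 3) :
    pd i (fun y => F (u y)) =ᶠ[𝓝 x] fun y => deriv F (u y) * pd i u y := by
  have h1 : ContDiffAt 𝕜 1 F (u x) := hF.of_le (by exact_mod_cast le_top)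
  filter_upwards [eventually_differentiableAt hu,
    hu.continuousAt.eventually (h1.eventually (by simp))] with y h2 h3
  exact pd_comp (h3.differentiableAt (by simp)) h2 i

theorem contDiffAt_deriv {F : 𝕜 → 𝕜} {s : 𝕜} (hF : ContDiffAt 𝕜 ∞ F s) :
    ContDiffAt 𝕜 ∞ (deriv F) s := by
  have : ContDiffAt 𝕜 ∞ (fderiv 𝕜 F) s := hF.fderiv_right (by simp)
  exact this.clm_apply contDiffAt_const

/-- If `u` has a critical point at `x`, then so has `F ∘ u`, and its Hessian there is that of `u`
up to the factor `F'`. -/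
theorem pd_pd_comp_of_critical {F : 𝕜 → 𝕜} {u : Space 𝕜 → 𝕜} (hF : ContDiffAt 𝕜 ∞ F (u x))
    (hu : ContDiffAt 𝕜 ∞ u x) (h0 : ∀ i, pd i u x = 0) (i j : Fin 3) :
    pd i (pd j (fun y => F (u y))) x = deriv F (u x) * pd i (pd j u) x := by
  rw [pd_congr (pd_comp_eventually hF hu j) i, pd_mul _ _, h0 j, mul_zero, zero_add]
  · exact ((contDiffAt_deriv hF).comp x hu).differentiableAt_of_infty
  · exact (contDiffAt_pd hu j).differentiableAt_of_infty

end Calculus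

/-! ### Jets modulo functions vanishing to a given order -/

section Vanishing

variable {𝕜 : Type*} [RCLike 𝕜]

/-- The germ of `f` at `x` is smooth and all its partial derivatives of order less than `n` vanish
at `x`. -/
def VanishesToOrder (x : Space 𝕜) : ℕ → (Space 𝕜 → 𝕜) → Prop
  | 0, f => ContDiffAt 𝕜 ∞ f x
  | n + 1, f => ContDiffAt 𝕜 ∞ f x ∧ f x = 0 ∧ ∀ i, VanishesToOrder x n (pd i f)

namespace VanishesToOrder

variable {f g : Space 𝕜 → 𝕜} {x : Space 𝕜} {m n : ℕ}

theorem contDiffAt (h : VanishesToOrder x n f) : ContDiffAt 𝕜 ∞ f x := by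
  cases n with
  | zero => exact h
  | succ n => exact h.1

theorem eq_zero (h : VanishesToOrder x (n + 1) f) : f x = 0 := h.2.1

theorem pd (h : VanishesToOrder x (n + 1) f) (i : Fin 3) :
    VanishesToOrder x n (TypeIEquation.pd i f) := h.2.2 i

theorem congr (h : VanishesToOrder x n f) (hfg : f =ᶠ[𝓝 x] g) : VanishesToOrder x n g := by
  induction n generalizing f g with
  | zero => exact ContDiffAt.congr_of_eventuallyEq h hfg.symm
  | succ n ih =>
    exact ⟨h.1.congr_of_eventuallyEq hfg.symm, hfg.eq_of_nhds ▸ h.2.1,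
      fun i => ih (h.2.2 i) (pd_eventuallyEq hfg i)⟩

theorem of_succ (h : VanishesToOrder x (n + 1) f) : VanishesToOrder x n f := by
  induction n generalizing f with
  | zero => exact h.1
  | succ n ih => exact ⟨h.1, h.2.1, fun i => ih (h.2.2 i)⟩

theorem mono (h : VanishesToOrder x n f) (hmn : m ≤ n) : VanishesToOrder x m f := by
  induction n, hmn using Nat.le_induction with
  | base => exact h
  | succ n _ ih => exact ih h.of_succ

theorem zero (n : ℕ) : VanishesToOrder x n (fun _ => (0 : 𝕜)) := by
  induction n with
  | zero => exact contDiffAt_const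
  | succ n ih => exact ⟨contDiffAt_const, rfl, fun i => by rw [pd_const]; exact ih⟩

theorem add (hf : VanishesToOrder x n f) (hg : VanishesToOrder x n g) :
    VanishesToOrder x n (fun y => f y + g y) := by
  induction n generalizing f g with
  | zero => exact ContDiffAt.add hf hg
  | succ n ih =>
    exact ⟨hf.1.add hg.1, by simp [hf.2.1, hg.2.1], fun i =>
      (ih (hf.2.2 i) (hg.2.2 i)).congr (pd_add_eventually hf.1 hg.1 i).symm⟩

theorem sum {ι : Type*} (s : Finset ι) {F : ι → Space 𝕜 → 𝕜}
    (hF : ∀ k ∈ s, VanishesToOrder x n (F k)) :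
    VanishesToOrder x n (fun y => ∑ k ∈ s, F k y) := by
  classical
  induction s using Finset.induction_on with
  | empty => simpa using zero n
  | insert a s ha ih =>
    simp only [Finset.sum_insert ha]
    exact (hF a (by simp)).add (ih fun k hk => hF k (by simp [hk]))

theorem mul (hf : VanishesToOrder x m f) (hg : VanishesToOrder x n g) :
    VanishesToOrder x (m + n) (fun y => f y * g y) := by
  -- the truncated bound lets the induction treat both terms of the product rule alike
  have key : ∀ N m n (f g : Space 𝕜 → 𝕜), N ≤ m + n → VanishesToOrder x m f →
      VanishesToOrder x n g → VanishesToOrder x N (fun y => f y * g y) := by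
    intro N
    induction N with
    | zero => intro m n f g _ hf hg; exact hf.contDiffAt.mul hg.contDiffAt
    | succ N ih =>
      intro m n f g hN hf hg
      have hpred : ∀ {k} {f : Space 𝕜 → 𝕜}, VanishesToOrder x k f → ∀ i,
          VanishesToOrder x (k - 1) (TypeIEquation.pd i f) := by
        intro k f h i
        cases k with
        | zero => exact contDiffAt_pd h i
        | succ k => exact h.2.2 i
      refine ⟨hf.contDiffAt.mul hg.contDiffAt, ?_, fun i => ?_⟩
      · cases m with
        | succ m => simp [hf.2.1]
        | zero =>
          cases n with
          | succ n => simp [hg.2.1]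
          | zero => omega
      · exact ((ih _ _ _ _ (by omega) (hpred hf i) hg).add
          (ih _ _ _ _ (by omega) hf (hpred hg i))).congr
          (pd_mul_eventually hf.contDiffAt hg.contDiffAt i).symm
  exact key _ m n f g le_rfl hf hg

theorem smooth_mul (hf : ContDiffAt 𝕜 ∞ f x) (hg : VanishesToOrder x n g) :
    VanishesToOrder x n (fun y => f y * g y) := by
  simpa using (show VanishesToOrder x 0 f from hf).mul hg

theorem sub (hf : VanishesToOrder x n f) (hg : VanishesToOrder x n g) :
    VanishesToOrder x n (fun y => f y - g y) := by
  simpa [sub_eq_add_neg] using hf.add (smooth_mul (contDiffAt_const (c := (-1 : 𝕜))) hg)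

theorem sub_apply_self (hf : ContDiffAt 𝕜 ∞ f x) : VanishesToOrder x 1 (fun y => f y - f x) :=
  ⟨hf.sub contDiffAt_const, sub_self _, fun i => contDiffAt_pd (hf.sub contDiffAt_const) i⟩

end VanishesToOrder

/-- The germs of `f` and `g` at `x` are smooth and agree modulo functions vanishing to order `n`,
that is, their `(n - 1)`-jets at `x` coincide. -/
def JetEq (x : Space 𝕜) (n : ℕ) (f g : Space 𝕜 → 𝕜) : Prop :=
  ContDiffAt 𝕜 ∞ f x ∧ ContDiffAt 𝕜 ∞ g x ∧ VanishesToOrder x n (fun y => f y - g y)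

namespace JetEq

variable {f g f' g' : Space 𝕜 → 𝕜} {x : Space 𝕜} {m n : ℕ}

theorem refl (hf : ContDiffAt 𝕜 ∞ f x) : JetEq x n f f :=
  ⟨hf, hf, by simpa using VanishesToOrder.zero n⟩

theorem congr (h : JetEq x n f g) (hf : f =ᶠ[𝓝 x] f') (hg : g =ᶠ[𝓝 x] g') : JetEq x n f' g' :=
  ⟨h.1.congr_of_eventuallyEq hf.symm, h.2.1.congr_of_eventuallyEq hg.symm,
    h.2.2.congr (hf.sub hg)⟩

theorem apply_eq (h : JetEq x (n + 1) f g) : f x = g x := sub_eq_zero.1 h.2.2.eq_zero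

theorem mono (h : JetEq x n f g) (hmn : m ≤ n) : JetEq x m f g := ⟨h.1, h.2.1, h.2.2.mono hmn⟩

theorem pd (h : JetEq x (n + 1) f g) (i : Fin 3) :
    JetEq x n (TypeIEquation.pd i f) (TypeIEquation.pd i g) :=
  ⟨contDiffAt_pd h.1 i, contDiffAt_pd h.2.1 i,
    (h.2.2.pd i).congr (pd_sub_eventually h.1 h.2.1 i)⟩

theorem add (h1 : JetEq x n f f') (h2 : JetEq x n g g') :
    JetEq x n (fun y => f y + g y) (fun y => f' y + g' y) :=
  ⟨h1.1.add h2.1, h1.2.1.add h2.2.1, (h1.2.2.add h2.2.2).congr (.of_forall fun y => by ring)⟩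

theorem sub (h1 : JetEq x n f f') (h2 : JetEq x n g g') :
    JetEq x n (fun y => f y - g y) (fun y => f' y - g' y) :=
  ⟨h1.1.sub h2.1, h1.2.1.sub h2.2.1, (h1.2.2.sub h2.2.2).congr (.of_forall fun y => by ring)⟩

theorem sum {ι : Type*} (s : Finset ι) {F G : ι → Space 𝕜 → 𝕜}
    (h : ∀ k ∈ s, JetEq x n (F k) (G k)) :
    JetEq x n (fun y => ∑ k ∈ s, F k y) (fun y => ∑ k ∈ s, G k y) :=
  ⟨ContDiffAt.sum fun k hk => (h k hk).1, ContDiffAt.sum fun k hk => (h k hk).2.1,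
    (VanishesToOrder.sum s fun k hk => (h k hk).2.2).congr
      (.of_forall fun y => by simp [Finset.sum_sub_distrib])⟩

/-- A factor is needed only up to order `m` if the other one vanishes to order `n`. -/
theorem mul (h1 : JetEq x m f f') (h2 : JetEq x (m + n) g g') (hg : VanishesToOrder x n g') :
    JetEq x (m + n) (fun y => f y * g y) (fun y => f' y * g' y) :=
  ⟨h1.1.mul h2.1, h1.2.1.mul h2.2.1,
    ((VanishesToOrder.smooth_mul h1.1 h2.2.2).add (h1.2.2.mul hg)).congr
      (.of_forall fun y => by ring)⟩

theorem const_mul (c : 𝕜) (h : JetEq x n f g) :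
    JetEq x n (fun y => c * f y) (fun y => c * g y) := by
  simpa using (refl (f := fun _ => c) contDiffAt_const (n := n)).mul (n := 0)
    (by simpa using h) h.2.1

theorem add_vanishes (h1 : JetEq x n f f') (h2 : VanishesToOrder x n g) :
    JetEq x n (fun y => f y + g y) f' :=
  ⟨h1.1.add h2.contDiffAt, h1.2.1, (h1.2.2.add h2).congr (.of_forall fun y => by ring)⟩

theorem vanishes (h : JetEq x n f g) (hg : VanishesToOrder x n g) : VanishesToOrder x n f :=
  (h.2.2.add hg).congr (.of_forall fun y => by ring)

end JetEq

end Vanishing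

/-! ### Linearized curvature -/

section LinearizedCurvature

variable {𝕜 : Type*} [RCLike 𝕜]

/-- The Christoffel symbols of the metric `G + q H`, linearized in `q`, where `G` and `H` are
constant and `W` is the inverse of `G`. -/
def linChristoffel (W H : Matrix (Fin 3) (Fin 3) 𝕜) (q : Space 𝕜 → 𝕜) (k i j : Fin 3)
    (y : Space 𝕜) : 𝕜 :=
  (1 / 2) * ∑ l, W k l * (H j l * pd i q y + H i l * pd j q y - H i j * pd l q y)

/-- The Ricci tensor of `G + q H`, linearized in `q`. -/
def linRicci (W H : Matrix (Fin 3) (Fin 3) 𝕜) (q : Space 𝕜 → 𝕜) (i j : Fin 3)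
    (y : Space 𝕜) : 𝕜 :=
  ∑ k, (pd k (linChristoffel W H q k i j) y - pd j (linChristoffel W H q k i k) y)

/-- The Schouten tensor of `G + q H`, linearized in `q`. -/
def linSchouten (W G H : Matrix (Fin 3) (Fin 3) 𝕜) (q : Space 𝕜 → 𝕜) (i j : Fin 3)
    (y : Space 𝕜) : 𝕜 :=
  linRicci W H q i j y - (1 / 4) * (∑ a, ∑ b, W a b * linRicci W H q a b y) * G i j

variable {W G H : Matrix (Fin 3) (Fin 3) 𝕜} {q : Space 𝕜 → 𝕜} {x : Space 𝕜}
  {g : Space 𝕜 → Matrix (Fin 3) (Fin 3) 𝕜}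

theorem vanishesToOrder_linChristoffel (hq : VanishesToOrder x 3 q) (k i j : Fin 3) :
    VanishesToOrder x 2 (linChristoffel W H q k i j) := by
  have h : ∀ (c : 𝕜) i, VanishesToOrder x 2 (fun y => c * pd i q y) := fun c i =>
    .smooth_mul contDiffAt_const (hq.pd i)
  refine .smooth_mul contDiffAt_const (.sum _ fun l _ => .smooth_mul contDiffAt_const ?_)
  exact ((h _ i).add (h _ j)).sub (h _ l)

theorem christoffel_jetEq (hq : VanishesToOrder x 3 q)
    (hg : ∀ i j l, JetEq x 3 (pd l (fun y => g y i j)) (fun y => H i j * pd l q y))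
    (hW : ∀ k l, JetEq x 1 (fun y => (g y)⁻¹ k l) (fun _ => W k l)) (k i j : Fin 3) :
    JetEq x 3 (christoffel g k i j) (linChristoffel W H q k i j) := by
  have h : ∀ (c : 𝕜) i, VanishesToOrder x 2 (fun y => c * pd i q y) := fun c i =>
    .smooth_mul contDiffAt_const (hq.pd i)
  refine .const_mul _ (.sum _ fun l _ => (hW k l).mul (n := 2) ?_ ?_)
  · exact ((hg j l i).add (hg i l j)).sub (hg i j l)
  · exact ((h _ i).add (h _ j)).sub (h _ l)

theorem vanishesToOrder_linRicci (hq : VanishesToOrder x 3 q) (i j : Fin 3) :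
    VanishesToOrder x 1 (linRicci W H q i j) :=
  .sum _ fun k _ => ((vanishesToOrder_linChristoffel hq k i j).pd k).sub
    ((vanishesToOrder_linChristoffel hq k i k).pd j)

theorem ricci_jetEq (hq : VanishesToOrder x 3 q)
    (hg : ∀ i j l, JetEq x 3 (pd l (fun y => g y i j)) (fun y => H i j * pd l q y))
    (hW : ∀ k l, JetEq x 1 (fun y => (g y)⁻¹ k l) (fun _ => W k l)) (i j : Fin 3) :
    JetEq x 2 (ricci g i j) (linRicci W H q i j) := by
  have hΓ := christoffel_jetEq hq hg hW
  have hΓ0 : ∀ k i j, VanishesToOrder x 2 (christoffel g k i j) := fun k i j =>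
    ((hΓ k i j).mono (by norm_num)).vanishes (vanishesToOrder_linChristoffel hq k i j)
  refine JetEq.add_vanishes
    (.sum _ fun k _ => ((hΓ k i j).pd k).sub ((hΓ k i k).pd j)) ?_
  refine .sum _ fun k _ => .sum _ fun l _ => .sub ?_ ?_
  · exact ((hΓ0 k k l).mul (hΓ0 l i j)).mono (by norm_num)
  · exact ((hΓ0 k j l).mul (hΓ0 l i k)).mono (by norm_num)

theorem schouten_jetEq (hq : VanishesToOrder x 3 q)
    (hg : ∀ i j l, JetEq x 3 (pd l (fun y => g y i j)) (fun y => H i j * pd l q y))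
    (hW : ∀ k l, JetEq x 1 (fun y => (g y)⁻¹ k l) (fun _ => W k l))
    (hG : ∀ k l, JetEq x 1 (fun y => g y k l) (fun _ => G k l)) (i j : Fin 3) :
    JetEq x 2 (schouten g i j) (linSchouten W G H q i j) := by
  have hR := ricci_jetEq hq hg hW
  have hS : JetEq x 2 (scalarCurvature g) (fun y => ∑ a, ∑ b, W a b * linRicci W H q a b y) :=
    .sum _ fun a _ => .sum _ fun b _ => (hW a b).mul (n := 1) (hR a b)
      (vanishesToOrder_linRicci hq a b)
  have hS0 : VanishesToOrder x 1 (fun y => ∑ a, ∑ b, W a b * linRicci W H q a b y) :=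
    .sum _ fun a _ => .sum _ fun b _ => .smooth_mul contDiffAt_const
      (vanishesToOrder_linRicci hq a b)
  have h2 := (hG i j).mul (n := 1) (hS.const_mul (1 / 4))
    (.smooth_mul contDiffAt_const hS0)
  exact (hR i j).sub (h2.congr (.of_forall fun y => mul_comm _ _)
    (.of_forall fun y => mul_comm _ _))

theorem cotton_eq_linSchouten (hq : VanishesToOrder x 3 q)
    (hg : ∀ i j l, JetEq x 3 (pd l (fun y => g y i j)) (fun y => H i j * pd l q y))
    (hW : ∀ k l, JetEq x 1 (fun y => (g y)⁻¹ k l) (fun _ => W k l))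
    (hG : ∀ k l, JetEq x 1 (fun y => g y k l) (fun _ => G k l)) (i j k : Fin 3) :
    cotton g i j k x
      = pd k (linSchouten W G H q i j) x - pd j (linSchouten W G H q i k) x := by
  have hP := schouten_jetEq hq hg hW hG
  have hΓ : ∀ k i j, christoffel g k i j x = 0 := fun k i j =>
    (christoffel_jetEq hq hg hW k i j).apply_eq.trans
      (vanishesToOrder_linChristoffel hq k i j).eq_zero
  simp only [cotton, covSchouten, hΓ, ((hP _ _).pd _).apply_eq]
  simp

/-- The derivative of the constant-coefficient combination that enters the linearized Christoffel
symbols, with an arbitrary family `F` in place of the first derivatives of `q`. -/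
theorem pd_christoffel_combination {F : Fin 3 → Space 𝕜 → 𝕜} {y : Space 𝕜}
    (hd : ∀ i, DifferentiableAt 𝕜 (F i) y) (m k i j : Fin 3) :
    pd m (fun y => (1 / 2) * ∑ l, W k l * (H j l * F i y + H i l * F j y - H i j * F l y)) y
      = (1 / 2) * ∑ l, W k l *
        (H j l * pd m (F i) y + H i l * pd m (F j) y - H i j * pd m (F l) y) := by
  have hd' : ∀ (c : 𝕜) i, DifferentiableAt 𝕜 (fun y => c * F i y) y := fun c i =>
    (hd i).const_mul c
  have h1 : ∀ l, DifferentiableAt 𝕜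
      (fun y => H j l * F i y + H i l * F j y - H i j * F l y) y := fun l =>
    ((hd' _ i).add (hd' _ j)).sub (hd' _ l)
  have h2 : ∀ l, DifferentiableAt 𝕜 (fun y => W k l *
      (H j l * F i y + H i l * F j y - H i j * F l y)) y := fun l => (h1 l).const_mul _
  rw [pd_const_mul (DifferentiableAt.fun_sum fun l _ => h2 l), pd_sum _ fun l _ => h2 l]
  congr 1
  refine Finset.sum_congr rfl fun l _ => ?_
  rw [pd_const_mul (h1 l), pd_sub ((hd' _ i).fun_add (hd' _ j)) (hd' _ l),
    pd_add (hd' _ i) (hd' _ j), pd_const_mul (hd i), pd_const_mul (hd j), pd_const_mul (hd l)]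

theorem contDiff_pd {f : Space 𝕜 → 𝕜} (hf : ContDiff 𝕜 ∞ f) (i : Fin 3) :
    ContDiff 𝕜 ∞ (pd i f) :=
  contDiff_iff_contDiffAt.2 fun _ => contDiffAt_pd hf.contDiffAt i

theorem pd_pd_linChristoffel (hq : ContDiff 𝕜 ∞ q) (n m k i j : Fin 3) (y : Space 𝕜) :
    pd n (pd m (linChristoffel W H q k i j)) y = (1 / 2) * ∑ l, W k l *
      (H j l * pd n (pd m (pd i q)) y + H i l * pd n (pd m (pd j q)) y
        - H i j * pd n (pd m (pd l q)) y) := by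
  have h1 : ∀ i y, DifferentiableAt 𝕜 (pd i q) y := fun i y =>
    (contDiff_pd hq i).contDiffAt.differentiableAt_of_infty
  have h2 : ∀ i y, DifferentiableAt 𝕜 (pd m (pd i q)) y := fun i y =>
    (contDiff_pd (contDiff_pd hq i) m).contDiffAt.differentiableAt_of_infty
  have h3 : pd m (linChristoffel W H q k i j) = _ :=
    funext fun y => pd_christoffel_combination (fun i => h1 i y) m k i j
  rw [h3, pd_christoffel_combination fun i => h2 i y]

/-- The `r`-th derivative of the linearized Ricci tensor in terms of the third derivatives `T` of
`q`, when these are trace-free with respect to `W`. -/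
theorem pd_linRicci (hq : ContDiff 𝕜 ∞ q) {T : Fin 3 → Fin 3 → Fin 3 → 𝕜}
    (hT : ∀ i j k, pd i (pd j (pd k q)) x = T i j k)
    (hT1 : ∀ i j k, T i j k = T j i k) (hT2 : ∀ i j k, T i j k = T i k j)
    (hWs : ∀ i j, W i j = W j i)
    (htr : ∀ r, ∑ i, ∑ j, W i j * T i j r = 0) (r i j : Fin 3) :
    pd r (linRicci W H q i j) x = (1 / 2) * ((∑ k, ∑ l, W k l * H j l * T k i r)
      + (∑ k, ∑ l, W k l * H i l * T k j r) - (∑ k, ∑ l, W k l * H k l) * T i j r) := by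
  have hs : ∀ m k i j, DifferentiableAt 𝕜 (pd m (linChristoffel W H q k i j)) x := by
    intro m k i j
    refine ContDiffAt.differentiableAt_of_infty (contDiffAt_pd ?_ m)
    unfold linChristoffel
    have := fun i => contDiff_pd hq i
    fun_prop
  have hc : ∀ a b c, T a b c = T b c a := fun a b c => by rw [hT1 a b c, hT2 b a c]
  unfold linRicci
  rw [pd_sum _ fun k _ => (hs _ _ _ _).fun_sub (hs _ _ _ _)]
  have h3 : ∀ k, pd r (fun y => pd k (linChristoffel W H q k i j) y
      - pd j (linChristoffel W H q k i k) y) x = (1 / 2) * ((∑ l, W k l * H j l * T k i r)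
      + (∑ l, W k l * H i l * T k j r) - H i j * (∑ l, W k l * T k l r)
      - (∑ l, W k l * H k l) * T i j r - (∑ l, W k l * H i l * T k j r)
      + H i k * ∑ l, W k l * T l j r) := by
    intro k
    rw [pd_sub (hs _ _ _ _) (hs _ _ _ _), pd_pd_linChristoffel hq, pd_pd_linChristoffel hq]
    simp only [hT, Finset.mul_sum, Finset.sum_mul, ← Finset.sum_add_distrib,
      ← Finset.sum_sub_distrib]
    refine Finset.sum_congr rfl fun l _ => ?_
    rw [hc r k i, hc r k j, hc r k l, hc r j i, hc r j k, hc r j l, hT1 j i r, hT1 j k r,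
      hT1 j l r]
    ring
  simp only [h3, ← Finset.mul_sum]
  congr 1
  simp only [Finset.sum_add_distrib, Finset.sum_sub_distrib, ← Finset.mul_sum, htr,
    ← Finset.sum_mul]
  have h4 : ∑ k, ∑ l, W k l * H i l * T k j r = ∑ k, H i k * ∑ l, W k l * T l j r := by
    simp only [Finset.mul_sum]
    rw [Finset.sum_comm]
    refine Finset.sum_congr rfl fun l _ => Finset.sum_congr rfl fun k _ => ?_
    rw [hWs k l]; ring
  simp only [← Finset.sum_mul] at h4
  rw [h4]; ring

theorem pd_linSchouten (hq : ContDiff 𝕜 ∞ q) (r i j : Fin 3) :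
    pd r (linSchouten W G H q i j) x = pd r (linRicci W H q i j) x
      - (1 / 4) * (∑ a, ∑ b, W a b * pd r (linRicci W H q a b) x) * G i j := by
  have hd : ∀ i j, DifferentiableAt 𝕜 (linRicci W H q i j) x := by
    intro i j
    have h1 : ∀ k i j, ContDiff 𝕜 ∞ (linChristoffel W H q k i j) := by
      intro k i j
      unfold linChristoffel
      have := fun i => contDiff_pd hq i
      fun_prop
    have h2 := fun m k i j => contDiff_pd (h1 k i j) m
    exact ContDiffAt.differentiableAt_of_infty
      (ContDiffAt.sum fun k _ => ((h2 _ _ _ _).sub (h2 _ _ _ _)).contDiffAt)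
  have hd1 : ∀ a b, DifferentiableAt 𝕜 (fun y => W a b * linRicci W H q a b y) x :=
    fun a b => (hd a b).const_mul _
  have hd2 : ∀ a, DifferentiableAt 𝕜 (fun y => ∑ b, W a b * linRicci W H q a b y) x :=
    fun a => DifferentiableAt.fun_sum fun b _ => hd1 a b
  have hd3 : DifferentiableAt 𝕜 (fun y => ∑ a, ∑ b, W a b * linRicci W H q a b y) x :=
    DifferentiableAt.fun_sum fun a _ => hd2 a
  have h4 : linSchouten W G H q i j = fun y => linRicci W H q i j y
      - (1 / 4 * G i j) * ∑ a, ∑ b, W a b * linRicci W H q a b y := by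
    funext y; simp only [linSchouten]; ring
  rw [h4, pd_sub (hd i j) (hd3.const_mul _), pd_const_mul hd3, pd_sum _ fun a _ => hd2 a]
  simp only [pd_sum _ fun b _ => hd1 _ b, pd_const_mul (hd _ _)]
  ring

end LinearizedCurvature

/-! ### The harmonic part of the cube of a covector -/

section Algebra

variable {𝕜 : Type*} [RCLike 𝕜]

open Matrix

/-- The trace-free part, with respect to the metric `G` with inverse `W`, of the cube of a
covector `α`. The coefficient of the trace correction is `|α|² / (n + 2)` in dimension `n = 3`. -/
def traceFreeCube (W G : Matrix (Fin 3) (Fin 3) 𝕜) (α : Fin 3 → 𝕜) (i j k : Fin 3) : 𝕜 :=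
  α i * α j * α k - (α ⬝ᵥ W *ᵥ α) / 5 * (α i * G j k + α j * G i k + α k * G i j)

variable {W G H : Matrix (Fin 3) (Fin 3) 𝕜} {α : Fin 3 → 𝕜}

theorem sum_mulVec_mul_inverse (hWs : ∀ i j, W i j = W j i) (hWG : W * G = 1) (r : Fin 3) :
    ∑ j, (W *ᵥ α) j * G j r = α r := by
  have h1 : (W *ᵥ α) ᵥ* G = α := by
    rw [← vecMul_transpose, vecMul_vecMul,
      show Wᵀ = W from Matrix.ext fun i j => hWs j i, hWG, vecMul_one]
  exact congrFun h1 r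

theorem sum_mul_one_apply (r : Fin 3) (β : Fin 3 → 𝕜) :
    ∑ j, β j * (1 : Matrix (Fin 3) (Fin 3) 𝕜) j r = β r := by
  simp [Matrix.one_apply]

theorem sum_mul_traceFreeCube (hWs : ∀ i j, W i j = W j i) (hWG : W * G = 1) (l i r : Fin 3) :
    ∑ k, W k l * traceFreeCube W G α k i r = (W *ᵥ α) l * α i * α r
      - (α ⬝ᵥ W *ᵥ α) / 5 * ((W *ᵥ α) l * G i r
        + α i * (1 : Matrix (Fin 3) (Fin 3) 𝕜) l r
        + α r * (1 : Matrix (Fin 3) (Fin 3) 𝕜) l i) := by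
  have h : ∀ i, W l 0 * G 0 i + W l 1 * G 1 i + W l 2 * G 2 i
      = (1 : Matrix (Fin 3) (Fin 3) 𝕜) l i := by
    intro i
    rw [← hWG, Matrix.mul_apply, Fin.sum_univ_three]
  have hv : (W *ᵥ α) l = W l 0 * α 0 + W l 1 * α 1 + W l 2 * α 2 := by
    simp [mulVec, dotProduct, Fin.sum_univ_three]
  unfold traceFreeCube
  generalize α ⬝ᵥ W *ᵥ α = a
  simp only [Fin.sum_univ_three]
  rw [← h i, ← h r, hv, hWs 0 l, hWs 1 l, hWs 2 l]
  ring

theorem trace_traceFreeCube (hWs : ∀ i j, W i j = W j i) (hWG : W * G = 1) (r : Fin 3) :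
    ∑ i, ∑ j, W i j * traceFreeCube W G α i j r = 0 := by
  rw [Finset.sum_comm]
  simp only [sum_mul_traceFreeCube hWs hWG]
  have h := sum_mulVec_mul_inverse (α := α) hWs hWG r
  have hD := sum_mul_one_apply r α
  have ha : α ⬝ᵥ W *ᵥ α = ∑ j, α j * (W *ᵥ α) j := rfl
  generalize α ⬝ᵥ W *ᵥ α = a at *
  simp only [Fin.sum_univ_three, one_apply_eq] at *
  linear_combination -a / 5 * h - a / 5 * hD - α r * ha

theorem sum_sum_mul_traceFreeCube (hWs : ∀ i j, W i j = W j i) (hWG : W * G = 1)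
    (j i r : Fin 3) :
    ∑ k, ∑ l, W k l * H j l * traceFreeCube W G α k i r
      = (H *ᵥ W *ᵥ α) j * α i * α r - (α ⬝ᵥ W *ᵥ α) / 5 *
        ((H *ᵥ W *ᵥ α) j * G i r + α i * H j r + α r * H j i) := by
  have h1 : ∑ k, ∑ l, W k l * H j l * traceFreeCube W G α k i r
      = ∑ l, H j l * ∑ k, W k l * traceFreeCube W G α k i r := by
    rw [Finset.sum_comm]
    simp only [Finset.mul_sum]
    exact Finset.sum_congr rfl fun l _ => Finset.sum_congr rfl fun k _ => by ring
  have hβ : (H *ᵥ W *ᵥ α) j = ∑ l, H j l * (W *ᵥ α) l := rfl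
  have hi := sum_mul_one_apply i (H j)
  have hr := sum_mul_one_apply r (H j)
  rw [h1]
  simp only [sum_mul_traceFreeCube hWs hWG]
  generalize α ⬝ᵥ W *ᵥ α = a at *
  simp only [Fin.sum_univ_three] at *
  rw [hβ]
  linear_combination - a / 5 * α i * hr - a / 5 * α r * hi

/-- If the linearized Cotton tensor of `G + q H` vanishes for the cubic `q` with third derivatives
`traceFreeCube W G α`, then `H W α` is parallel to `α`, provided that `α` is not null. This is
obtained by contracting the Cotton tensor with the vector `W α`. -/
theorem wedge_eq_zero_of_linCotton_eq_zero (hWs : ∀ i j, W i j = W j i)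
    (hGs : ∀ i j, G i j = G j i) (hHs : ∀ i j, H i j = H j i) (hWG : W * G = 1)
    {N : Fin 3 → Fin 3 → Fin 3 → 𝕜}
    (hN : ∀ r i j, N r i j = (1 / 2) * ((∑ k, ∑ l, W k l * H j l * traceFreeCube W G α k i r)
      + (∑ k, ∑ l, W k l * H i l * traceFreeCube W G α k j r)
      - (∑ k, ∑ l, W k l * H k l) * traceFreeCube W G α i j r))
    (hC : ∀ p q r, (N r p q - (1 / 4) * (∑ a, ∑ b, W a b * N r a b) * G p q)
      - (N q p r - (1 / 4) * (∑ a, ∑ b, W a b * N q a b) * G p r) = 0) (q r : Fin 3) :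
    (α ⬝ᵥ W *ᵥ α) * ((H *ᵥ W *ᵥ α) q * α r - (H *ᵥ W *ᵥ α) r * α q) = 0 := by
  have hN' : ∀ r i j, N r i j = (1 / 2) * (
      ((H *ᵥ W *ᵥ α) j * α i * α r - (α ⬝ᵥ W *ᵥ α) / 5 *
        ((H *ᵥ W *ᵥ α) j * G i r + α i * H j r + α r * H i j)) +
      ((H *ᵥ W *ᵥ α) i * α j * α r - (α ⬝ᵥ W *ᵥ α) / 5 *
        ((H *ᵥ W *ᵥ α) i * G j r + α j * H i r + α r * H i j))
      - (∑ k, ∑ l, W k l * H k l) * (α i * α j * α r - (α ⬝ᵥ W *ᵥ α) / 5 *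
        (α i * G j r + α j * G i r + α r * G i j))) := by
    intro r i j
    rw [hN, sum_sum_mul_traceFreeCube hWs hWG, sum_sum_mul_traceFreeCube hWs hWG, hHs j i]
    rfl
  have hvH : ∀ r, ∑ j, (W *ᵥ α) j * H j r = (H *ᵥ W *ᵥ α) r := by
    intro r
    simp only [mulVec, dotProduct]
    exact Finset.sum_congr rfl fun j _ => by rw [hHs j r]; ring
  -- the derivative of the scalar curvature
  have hτ : ∀ r, ∑ a, ∑ b, W a b * N r a b = (H *ᵥ W *ᵥ α) ⬝ᵥ (W *ᵥ α) * α r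
      - (α ⬝ᵥ W *ᵥ α) / 5 * (2 * (H *ᵥ W *ᵥ α) r + (∑ k, ∑ l, W k l * H k l) * α r) := by
    intro r
    set P : Fin 3 → Fin 3 → 𝕜 := fun j i =>
      ∑ k, ∑ l, W k l * H j l * traceFreeCube W G α k i r with hP
    have h1 : ∑ a, ∑ b, W a b * N r a b = ∑ b, ∑ a, W b a * P b a := by
      have h2 : ∀ a b, W a b * N r a b = (1 / 2) * (W b a * P b a) + (1 / 2) * (W a b * P a b)
          - (1 / 2) * (∑ k, ∑ l, W k l * H k l) * (W a b * traceFreeCube W G α a b r) := by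
        intro a b
        rw [hN, hP, hWs b a]; ring
      simp only [h2, Finset.sum_add_distrib, Finset.sum_sub_distrib, ← Finset.mul_sum,
        trace_traceFreeCube hWs hWG]
      rw [Finset.sum_comm]
      ring
    have h3 : ∀ b, ∑ a, W b a * P b a = (H *ᵥ W *ᵥ α) b * (W *ᵥ α) b * α r
        - (α ⬝ᵥ W *ᵥ α) / 5 * ((H *ᵥ W *ᵥ α) b * (1 : Matrix (Fin 3) (Fin 3) 𝕜) b r
          + (W *ᵥ α) b * H b r + α r * ∑ a, W b a * H b a) := by
      intro b
      have hv : (W *ᵥ α) b = W b 0 * α 0 + W b 1 * α 1 + W b 2 * α 2 := by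
        simp [mulVec, dotProduct, Fin.sum_univ_three]
      have hD : (1 : Matrix (Fin 3) (Fin 3) 𝕜) b r
          = W b 0 * G 0 r + W b 1 * G 1 r + W b 2 * G 2 r := by
        rw [← hWG, Matrix.mul_apply, Fin.sum_univ_three]
      simp only [hP, sum_sum_mul_traceFreeCube hWs hWG]
      generalize α ⬝ᵥ W *ᵥ α = a at *
      generalize H *ᵥ W *ᵥ α = β at *
      simp only [Fin.sum_univ_three, hv, hD]
      ring
    have hD := sum_mul_one_apply r (H *ᵥ W *ᵥ α)
    have hvH := hvH r
    rw [h1]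
    simp only [h3, Finset.sum_add_distrib, Finset.sum_sub_distrib, ← Finset.mul_sum,
      ← Finset.sum_mul, hD, hvH]
    rw [show ∑ i, (H *ᵥ W *ᵥ α) i * (W *ᵥ α) i = (H *ᵥ W *ᵥ α) ⬝ᵥ (W *ᵥ α) from rfl]
    ring
  have hvG := fun r => sum_mulVec_mul_inverse (α := α) hWs hWG r
  have ha : α ⬝ᵥ W *ᵥ α = ∑ j, α j * (W *ᵥ α) j := rfl
  have hC' : ∑ p, (W *ᵥ α) p * ((N r p q - (1 / 4) * (∑ a, ∑ b, W a b * N r a b) * G p q)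
      - (N q p r - (1 / 4) * (∑ a, ∑ b, W a b * N q a b) * G p r)) = 0 := by
    simp only [hC]; simp
  simp only [hτ] at hC'
  simp only [hN'] at hC'
  generalize α ⬝ᵥ W *ᵥ α = a at *
  generalize (H *ᵥ W *ᵥ α) ⬝ᵥ (W *ᵥ α) = b at *
  generalize (∑ k, ∑ l, W k l * H k l) = h at *
  generalize H *ᵥ W *ᵥ α = β at *
  generalize W *ᵥ α = v at *
  have e1 := hvG q
  have e2 := hvG r
  have e3 := hvH q
  have e4 := hvH r
  simp only [Fin.sum_univ_three] at *
  rw [hGs r q, hHs r q] at hC'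
  linear_combination 5 * hC' + 5 * (a / 10 * β q
      - (1 / 4) * (b * α q - a / 5 * (2 * β q + h * α q))) * e2
    - 5 * (a / 10 * β r - (1 / 4) * (b * α r - a / 5 * (2 * β r + h * α r))) * e1
    + a / 2 * α r * e3 - a / 2 * α q * e4 + 5 / 2 * (β q * α r - β r * α q) * ha

end Algebra

/-! ### Scalar matrices, quadratic and cubic forms -/

section Scalar

variable {𝕜 : Type*} [RCLike 𝕜]

open Matrix

theorem exists_dotProduct_mulVec_ne_zero {W : Matrix (Fin 3) (Fin 3) 𝕜}
    (hWs : ∀ i j, W i j = W j i) (hW : W ≠ 0) : ∃ β, β ⬝ᵥ W *ᵥ β ≠ 0 := by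
  by_contra! h
  apply hW
  ext i j
  have h1 : ∀ i, W i i = 0 := fun i => by
    simpa using h (Pi.single i 1)
  have h2 := h (Pi.single i 1 + Pi.single j 1)
  simp only [mulVec_add, dotProduct_add, add_dotProduct, single_dotProduct, mulVec_single_one,
    col_apply, h1, hWs j i] at h2
  simpa [← two_mul] using h2

/-- If every non-null vector is an eigenvector of `K`, then `K` is scalar. The null vectors are
covered because the two factors of the hypothesis are polynomials on every line, and the first one
is nonzero on suitable lines. -/
theorem isScalar_of_wedge_eq_zero {W K : Matrix (Fin 3) (Fin 3) 𝕜}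
    (hWs : ∀ i j, W i j = W j i) (hW : W ≠ 0)
    (h : ∀ α q r, (α ⬝ᵥ W *ᵥ α) * ((K *ᵥ α) q * α r - (K *ᵥ α) r * α q) = 0) :
    ∃ c : 𝕜, K = c • 1 := by
  have hB : ∀ α q r, (K *ᵥ α) q * α r - (K *ᵥ α) r * α q = 0 := by
    intro α q r
    obtain ⟨β, hβ⟩ := exists_dotProduct_mulVec_ne_zero hWs hW
    -- the two factors restricted to the line `t ↦ α + t β`
    let P : Polynomial 𝕜 := .C (α ⬝ᵥ W *ᵥ α) + .C (α ⬝ᵥ W *ᵥ β + β ⬝ᵥ W *ᵥ α) * .X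
      + .C (β ⬝ᵥ W *ᵥ β) * .X ^ 2
    let Q : Polynomial 𝕜 := .C ((K *ᵥ α) q * α r - (K *ᵥ α) r * α q)
      + .C ((K *ᵥ α) q * β r + (K *ᵥ β) q * α r - (K *ᵥ α) r * β q - (K *ᵥ β) r * α q) * .X
      + .C ((K *ᵥ β) q * β r - (K *ᵥ β) r * β q) * .X ^ 2
    have hPQ : P * Q = 0 := by
      refine Polynomial.funext fun t => ?_
      have := h (α + t • β) q r
      simp only [mulVec_add, mulVec_smul, dotProduct_add, add_dotProduct, smul_dotProduct,
        dotProduct_smul, Pi.add_apply, Pi.smul_apply, smul_eq_mul] at this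
      simp only [P, Q, Polynomial.eval_mul, Polynomial.eval_add, Polynomial.eval_C,
        Polynomial.eval_X, Polynomial.eval_pow, Polynomial.eval_zero]
      rw [← this]; ring
    have hP : P ≠ 0 := by
      intro h0
      apply hβ
      have := congrArg (fun p => p.coeff 2) h0
      simpa [P, Polynomial.coeff_X, Polynomial.coeff_C] using this
    have hQ : Q = 0 := (mul_eq_zero.1 hPQ).resolve_left hP
    have := congrArg (fun p => p.eval 0) hQ
    simpa [Q] using this
  have hoff : ∀ i j, i ≠ j → K i j = 0 := by
    intro i j hij
    simpa [hij, hij.symm] using hB (Pi.single j 1) i j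
  have hdiag : ∀ i j, K i i = K j j := by
    intro i j
    by_cases hij : i = j
    · rw [hij]
    have := hB (Pi.single i 1 + Pi.single j 1) i j
    simpa [mulVec_add, hij, Ne.symm hij, hoff i j hij, hoff j i (Ne.symm hij), sub_eq_zero]
      using this
  refine ⟨K 0 0, ?_⟩
  ext i j
  by_cases hij : i = j
  · subst hij; simp [hdiag i 0]
  · simp [hij, hoff i j hij]

end Scalar

section Forms

variable {𝕜 : Type*} [RCLike 𝕜]

/-- The quadratic form `∑ S_{jk} y_j y_k`. -/
def quadForm (S : Fin 3 → Fin 3 → 𝕜) (y : Space 𝕜) : 𝕜 := ∑ j, y j * ∑ k, S j k * y k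

/-- The cubic form `∑ T_{ijk} y_i y_j y_k`. -/
def cubicForm (T : Fin 3 → Fin 3 → Fin 3 → 𝕜) (y : Space 𝕜) : 𝕜 := ∑ j, y j * quadForm (T j) y

theorem contDiff_linForm (c : Fin 3 → 𝕜) : ContDiff 𝕜 ∞ (fun y : Space 𝕜 => ∑ k, c k * y k) := by
  fun_prop

theorem contDiff_quadForm (S : Fin 3 → Fin 3 → 𝕜) : ContDiff 𝕜 ∞ (quadForm S) := by
  unfold quadForm; fun_prop

theorem contDiff_cubicForm (T : Fin 3 → Fin 3 → Fin 3 → 𝕜) : ContDiff 𝕜 ∞ (cubicForm T) := by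
  have := fun j => contDiff_quadForm (T j)
  unfold cubicForm; fun_prop

theorem differentiableAt_coord (j : Fin 3) (y : Space 𝕜) :
    DifferentiableAt 𝕜 (fun y : Space 𝕜 => y j) y := by fun_prop

theorem pd_sum_coord_mul {F : Fin 3 → Space 𝕜 → 𝕜} {y : Space 𝕜}
    (hF : ∀ j, DifferentiableAt 𝕜 (F j) y) (a : Fin 3) :
    pd a (fun y => ∑ j, y j * F j y) y = F a y + ∑ j, y j * pd a (F j) y := by
  rw [pd_sum _ fun j _ => (differentiableAt_coord j y).fun_mul (hF j)]
  simp only [pd_mul (differentiableAt_coord _ y) (hF _), Finset.sum_add_distrib, pd_coord]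
  simp

theorem pd_linForm (c : Fin 3 → 𝕜) (a : Fin 3) :
    pd a (fun y : Space 𝕜 => ∑ k, c k * y k) = fun _ => c a := by
  funext y
  simp only [mul_comm (c _)]
  rw [pd_sum_coord_mul (F := fun k _ => c k) fun _ => differentiableAt_const _]
  simp [pd_const]

theorem pd_quadForm {S : Fin 3 → Fin 3 → 𝕜} (hS : ∀ i j, S i j = S j i) (a : Fin 3) :
    pd a (quadForm S) = fun y => 2 * ∑ k, S a k * y k := by
  funext y
  unfold quadForm
  rw [pd_sum_coord_mul fun j => (contDiff_linForm (S j)).contDiffAt.differentiableAt_of_infty]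
  simp only [pd_linForm, two_mul]
  congr 1
  exact Finset.sum_congr rfl fun j _ => by rw [hS a j, mul_comm]

theorem pd_pd_quadForm {S : Fin 3 → Fin 3 → 𝕜} (hS : ∀ i j, S i j = S j i) (b a : Fin 3) :
    pd b (pd a (quadForm S)) = fun _ => 2 * S a b := by
  funext y
  rw [pd_quadForm hS, pd_const_mul (contDiff_linForm (S a)).contDiffAt.differentiableAt_of_infty,
    pd_linForm]

theorem pd_cubicForm {T : Fin 3 → Fin 3 → Fin 3 → 𝕜} (hT1 : ∀ i j k, T i j k = T j i k)
    (hT2 : ∀ i j k, T i j k = T i k j) (a : Fin 3) :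
    pd a (cubicForm T) = fun y => 3 * quadForm (T a) y := by
  funext y
  unfold cubicForm
  rw [pd_sum_coord_mul fun j => (contDiff_quadForm (T j)).contDiffAt.differentiableAt_of_infty]
  simp only [pd_quadForm (hT2 _)]
  rw [show (3 : 𝕜) = 1 + 2 by norm_num, add_mul, one_mul]
  congr 1
  unfold quadForm
  rw [Finset.mul_sum]
  exact Finset.sum_congr rfl fun j _ => by simp only [hT1 j a]; ring

theorem pd_pd_pd_cubicForm {T : Fin 3 → Fin 3 → Fin 3 → 𝕜} (hT1 : ∀ i j k, T i j k = T j i k)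
    (hT2 : ∀ i j k, T i j k = T i k j) (c b a : Fin 3) :
    pd c (pd b (pd a (cubicForm T))) = fun _ => 6 * T c b a := by
  have hd : ∀ y, DifferentiableAt 𝕜 (quadForm (T a)) y := fun y =>
    (contDiff_quadForm (T a)).contDiffAt.differentiableAt_of_infty
  have h1 : pd b (pd a (cubicForm T)) = fun y => 3 * pd b (quadForm (T a)) y := by
    funext y
    rw [pd_cubicForm hT1 hT2, pd_const_mul (hd y)]
  funext y
  rw [h1, pd_const_mul (contDiff_pd (contDiff_quadForm _) b).contDiffAt.differentiableAt_of_infty,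
    pd_pd_quadForm (hT2 a), hT2 c b a, hT1 c a b, hT2 a c b]
  ring

theorem vanishesToOrder_cubicForm {T : Fin 3 → Fin 3 → Fin 3 → 𝕜}
    (hT1 : ∀ i j k, T i j k = T j i k) (hT2 : ∀ i j k, T i j k = T i k j) :
    VanishesToOrder (0 : Space 𝕜) 3 (cubicForm T) := by
  have h0 := contDiff_cubicForm T
  have h1 := fun a => contDiff_pd h0 a
  have h2 := fun a b => contDiff_pd (h1 a) b
  refine ⟨h0.contDiffAt, by simp [cubicForm], fun a => ⟨(h1 a).contDiffAt, ?_, fun b =>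
    ⟨(h2 a b).contDiffAt, ?_, fun c => (contDiff_pd (h2 a b) c).contDiffAt⟩⟩⟩
  · simp [pd_cubicForm hT1 hT2, quadForm]
  · rw [pd_cubicForm hT1 hT2,
      pd_const_mul (contDiff_quadForm (T a)).contDiffAt.differentiableAt_of_infty,
      pd_quadForm (hT2 a)]
    simp

end Forms

/-! ### Conformal flatness forces `V` and its derivative to be proportional -/

section Jets

variable {𝕜 : Type*} [RCLike 𝕜]

theorem jetEq_const {f : Space 𝕜 → 𝕜} {x : Space 𝕜} (hf : ContDiffAt 𝕜 ∞ f x) :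
    JetEq x 1 f (fun _ => f x) :=
  ⟨hf, contDiffAt_const, .sub_apply_self hf⟩

theorem jetEq_pd_comp {q : Space 𝕜 → 𝕜} {x : Space 𝕜} {F : 𝕜 → 𝕜} {s : 𝕜}
    (hF : ContDiffAt 𝕜 ∞ F s) (hq : VanishesToOrder x 3 q) (i : Fin 3) :
    JetEq x 3 (pd i (fun y => F (s + q y))) (fun y => deriv F s * pd i q y) := by
  have hu : ContDiffAt 𝕜 ∞ (fun y => s + q y) x := contDiffAt_const.add hq.contDiffAt
  have hux : s + q x = s := by rw [hq.eq_zero, add_zero]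
  have hF' : ContDiffAt 𝕜 ∞ F (s + q x) := by rwa [hux]
  have h1 : pd i (fun y => s + q y) =ᶠ[𝓝 x] pd i q := by
    refine (pd_add_eventually contDiffAt_const hq.contDiffAt i).trans (.of_forall fun y => ?_)
    simp [pd_const]
  have h2 := pd_comp_eventually hF' hu i
  have h3 : JetEq x 1 (fun y => deriv F (s + q y)) (fun _ => deriv F s) := by
    have := jetEq_const ((contDiffAt_deriv hF').comp x hu)
    simpa [Function.comp_def, hux] using this
  refine (h3.mul (n := 2) (.refl (contDiffAt_pd hq.contDiffAt i)) (hq.pd i)).congr ?_ .rfl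
  filter_upwards [h1, h2] with y hy1 hy2
  rw [hy2, hy1]

theorem jetEq_pd_pd_comp {q : Space 𝕜 → 𝕜} {x : Space 𝕜} {F : 𝕜 → 𝕜} {s : 𝕜}
    (hF : ContDiffAt 𝕜 ∞ F s) (hq : VanishesToOrder x 3 q) (i j : Fin 3) :
    JetEq x 2 (pd i (pd j (fun y => F (s + q y)))) (fun y => deriv F s * pd i (pd j q) y) := by
  refine ((jetEq_pd_comp hF hq j).pd i).congr .rfl ?_
  filter_upwards [eventually_differentiableAt (contDiffAt_pd hq.contDiffAt j)] with y hy
  exact pd_const_mul hy _ i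

end Jets

namespace Coeffs

variable {𝕜 : Type*} [RCLike 𝕜] {E : Coeffs 𝕜} {U : Set 𝕜} {s : 𝕜}

theorem inv_apply_symm {M : Matrix (Fin 3) (Fin 3) 𝕜} (hM : ∀ i j, M i j = M j i) (i j : Fin 3) :
    M⁻¹ i j = M⁻¹ j i := by
  have hT : M.transpose = M := Matrix.ext fun i j => hM j i
  conv_lhs => rw [← hT, ← Matrix.transpose_nonsing_inv, Matrix.transpose_apply]

theorem V_symm (E : Coeffs 𝕜) (s : 𝕜) (i j : Fin 3) : E.V s i j = E.V s j i := by
  fin_cases i <;> fin_cases j <;> rfl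

/-- The coefficient function under `∂_i ∂_j`, whose derivative is the entry `V i j`. -/
def entry (E : Coeffs 𝕜) (i j : Fin 3) : 𝕜 → 𝕜 :=
  !![E.a, E.p, E.q; E.p, E.b, E.r; E.q, E.r, E.c] i j

theorem deriv_entry (E : Coeffs 𝕜) (i j : Fin 3) (s : 𝕜) : deriv (E.entry i j) s = E.V s i j := by
  fin_cases i <;> fin_cases j <;> rfl

theorem contDiffAt_entry (hUo : IsOpen U) (hE : E.SmoothOn U) (hs : s ∈ U) (i j : Fin 3) :
    ContDiffAt 𝕜 ∞ (E.entry i j) s := by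
  obtain ⟨ha, hb, hc, hp, hq, hr⟩ := hE
  have h : ∀ {f : 𝕜 → 𝕜}, ContDiffOn 𝕜 ∞ f U → ContDiffAt 𝕜 ∞ f s := fun hf =>
    hf.contDiffAt (hUo.mem_nhds hs)
  fin_cases i <;> fin_cases j <;> simp [entry] <;> apply h <;> assumption

theorem contDiffAt_V (hUo : IsOpen U) (hE : E.SmoothOn U) (hs : s ∈ U) (i j : Fin 3) :
    ContDiffAt 𝕜 ∞ (fun σ => E.V σ i j) s := by
  simp only [← deriv_entry]
  exact contDiffAt_deriv (contDiffAt_entry hUo hE hs i j)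

theorem contDiffAt_V_inv (hUo : IsOpen U) (hE : E.SmoothOn U) (hs : s ∈ U)
    (hV : (E.V s).det ≠ 0) (i j : Fin 3) :
    ContDiffAt 𝕜 ∞ (fun σ => (E.V σ)⁻¹ i j) s := by
  have h := fun i j => contDiffAt_V hUo hE hs i j
  have hdet : ContDiffAt 𝕜 ∞ (fun σ => (E.V σ).det) s := by
    simp only [Matrix.det_fin_three]
    fun_prop
  have hadj : ContDiffAt 𝕜 ∞ (fun σ => (E.V σ).adjugate i j) s := by
    simp only [Matrix.adjugate_fin_three]
    fin_cases i <;> fin_cases j <;> simp <;> fun_prop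
  simp only [Matrix.inv_def, Ring.inverse_eq_inv', Matrix.smul_apply, smul_eq_mul]
  exact (hdet.inv hV).mul hadj

/-- The left-hand side of the equation as a double sum over the coefficient functions. -/
theorem lhs_eq_sum (E : Coeffs 𝕜) {u : Space 𝕜 → 𝕜} {x : Space 𝕜}
    (h : ∀ i j, ContDiffAt 𝕜 2 (fun z => E.entry i j (u z)) x) :
    E.lhs u x = ∑ i, ∑ j, pd i (pd j fun z => E.entry i j (u z)) x := by
  simp only [Fin.sum_univ_three]
  rw [pd_comm (h 1 0) 1 0, pd_comm (h 2 0) 2 0, pd_comm (h 2 1) 2 1]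
  simp only [lhs, entry, Matrix.of_apply, Matrix.cons_val]
  ring

/-- For `u = s + q` with `q` vanishing to third order, the equation reduces, up to second order, to
the constant-coefficient equation with symbol `V s`. -/
theorem lhs_jetEq (hUo : IsOpen U) (hE : E.SmoothOn U) (hs : s ∈ U) {q : Space 𝕜 → 𝕜}
    {x : Space 𝕜} (hq : VanishesToOrder x 3 q) :
    JetEq x 2 (E.lhs fun y => s + q y) (fun y => ∑ i, ∑ j, E.V s i j * pd i (pd j q) y) := by
  have h := fun i j => contDiffAt_entry hUo hE hs i j
  have h1 : JetEq x 2 (fun y => ∑ i, ∑ j, pd i (pd j fun z => E.entry i j (s + q z)) y)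
      (fun y => ∑ i, ∑ j, E.V s i j * pd i (pd j q) y) := by
    simp only [← deriv_entry]
    exact .sum _ fun i _ => .sum _ fun j _ => jetEq_pd_pd_comp (h i j) hq i j
  refine h1.congr ?_ .rfl
  have h2 : ∀ i j, ∀ᶠ y in 𝓝 x, ContDiffAt 𝕜 2 (fun z => E.entry i j (s + q z)) y := by
    intro i j
    have h3 : ContDiffAt 𝕜 ∞ (E.entry i j) (s + q x) := by
      rw [hq.eq_zero, add_zero]; exact h i j
    have h4 := h3.comp x (contDiffAt_const.add hq.contDiffAt : ContDiffAt 𝕜 ∞ (fun z => s + q z) x)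
    exact (contDiffAt_infty.1 h4 2).eventually (by simp)
  filter_upwards [eventually_all.2 fun i => eventually_all.2 fun j => h2 i j] with y hy
  exact (E.lhs_eq_sum hy).symm

/-- For `u = s + q` with `q` vanishing to third order, the Cotton tensor of the metric at that point
is the linearized one. -/
theorem cotton_metric_eq_linSchouten (hUo : IsOpen U) (hE : E.SmoothOn U) (hs : s ∈ U)
    (hV : (E.V s).det ≠ 0) {q : Space 𝕜 → 𝕜} {x : Space 𝕜} (hq : VanishesToOrder x 3 q)
    (i j k : Fin 3) :
    cotton (E.metric fun y => s + q y) i j k x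
      = pd k (linSchouten (E.V s) (E.V s)⁻¹
          (.of fun i j => deriv (fun σ => (E.V σ)⁻¹ i j) s) q i j) x
        - pd j (linSchouten (E.V s) (E.V s)⁻¹
          (.of fun i j => deriv (fun σ => (E.V σ)⁻¹ i j) s) q i k) x := by
  have hinv := contDiffAt_V_inv hUo hE hs hV
  have hVs := contDiffAt_V hUo hE hs
  have hux : s + q x = s := by rw [hq.eq_zero, add_zero]
  have hu : ContDiffAt 𝕜 ∞ (fun y => s + q y) x := contDiffAt_const.add hq.contDiffAt
  have hcomp : ∀ {F : 𝕜 → 𝕜}, ContDiffAt 𝕜 ∞ F s →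
      JetEq x 1 (fun y => F (s + q y)) (fun _ => F s) := by
    intro F hF
    have hF' : ContDiffAt 𝕜 ∞ F (s + q x) := by rwa [hux]
    simpa [Function.comp_def, hux] using jetEq_const (hF'.comp x hu)
  refine cotton_eq_linSchouten hq ?_ ?_ ?_ i j k
  · intro i j l
    exact jetEq_pd_comp (hinv i j) hq l
  · intro k l
    refine (hcomp (hVs k l)).congr ?_ .rfl
    have hdet : ContinuousAt (fun y => (E.V (s + q y)).det) x := by
      simp only [Matrix.det_fin_three]
      have := fun i j => (hcomp (hVs i j)).1.continuousAt
      fun_prop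
    filter_upwards [hdet.eventually_ne (by rwa [hux])] with y hy
    rw [metric, Matrix.nonsing_inv_nonsing_inv _ (isUnit_iff_ne_zero.2 hy)]
  · intro k l
    exact hcomp (hinv k l)

theorem deriv_V_inv (hUo : IsOpen U) (hE : E.SmoothOn U) (hs : s ∈ U)
    (hV : ∀ s ∈ U, (E.V s).det ≠ 0) :
    (Matrix.of fun i j => deriv (fun σ => E.V σ i j) s) * (E.V s)⁻¹
      + E.V s * (Matrix.of fun i j => deriv (fun σ => (E.V σ)⁻¹ i j) s) = 0 := by
  ext i j
  have hinv := fun i j => (contDiffAt_V_inv hUo hE hs (hV s hs) i j).differentiableAt (by simp)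
  have hVs := fun i j => (contDiffAt_V hUo hE hs i j).differentiableAt (by simp)
  have h1 : (fun σ => ∑ k, E.V σ i k * (E.V σ)⁻¹ k j) =ᶠ[𝓝 s]
      fun _ => (1 : Matrix (Fin 3) (Fin 3) 𝕜) i j := by
    filter_upwards [hUo.mem_nhds hs] with σ hσ
    rw [← Matrix.mul_apply, Matrix.mul_nonsing_inv _ (isUnit_iff_ne_zero.2 (hV σ hσ))]
  have h2 := h1.deriv_eq
  rw [deriv_const, deriv_fun_sum fun k _ => (hVs i k).fun_mul (hinv k j)] at h2
  simp only [deriv_fun_mul (hVs _ _) (hinv _ _), Finset.sum_add_distrib] at h2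
  simpa [Matrix.mul_apply] using h2

/-- Conformal flatness on all solutions forces `V'` to be a multiple of `V`. -/
theorem ConformallyFlatOnSolutions.exists_deriv_V_eq (hUo : IsOpen U) (hE : E.SmoothOn U)
    (hV : ∀ s ∈ U, (E.V s).det ≠ 0) (hF : E.ConformallyFlatOnSolutions U) (hs : s ∈ U) :
    ∃ c : 𝕜, ∀ i j, deriv (fun σ => E.V σ i j) s = c * E.V s i j := by
  have hu := isUnit_iff_ne_zero.2 (hV s hs)
  set H : Matrix (Fin 3) (Fin 3) 𝕜 := .of fun i j => deriv (fun σ => (E.V σ)⁻¹ i j) s with hH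
  have hinvs : ∀ σ i j, (E.V σ)⁻¹ i j = (E.V σ)⁻¹ j i := fun σ => inv_apply_symm (E.V_symm σ)
  have hHs : ∀ i j, H i j = H j i := by
    intro i j
    simp only [hH, Matrix.of_apply, hinvs _ i j]
  have hWG := Matrix.mul_nonsing_inv _ hu
  have hwedge : ∀ α q r, (α ⬝ᵥ (E.V s).mulVec α) *
      (((H * E.V s).mulVec α) q * α r - ((H * E.V s).mulVec α) r * α q) = 0 := by
    intro α q r
    set T := traceFreeCube (E.V s) (E.V s)⁻¹ α with hT
    have hT1 : ∀ i j k, T i j k = T j i k := fun i j k => by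
      simp only [hT, traceFreeCube, hinvs s i j]; ring
    have hT2 : ∀ i j k, T i j k = T i k j := fun i j k => by
      simp only [hT, traceFreeCube, hinvs s j k]; ring
    have htr : ∀ r, ∑ i, ∑ j, E.V s i j * T i j r = 0 := trace_traceFreeCube (E.V_symm s) hWG
    -- the test solution `s + φ`: a cubic with third derivatives `T`, harmonic for `V s`
    set φ : Space 𝕜 → 𝕜 := fun y => (1 / 6) * cubicForm T y with hφ
    have hφs : ContDiff 𝕜 ∞ φ := contDiff_const.mul (contDiff_cubicForm T)
    have hφv : VanishesToOrder 0 3 φ :=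
      .smooth_mul contDiffAt_const (vanishesToOrder_cubicForm hT1 hT2)
    have hφ3 : ∀ i j k x, pd i (pd j (pd k φ)) x = T i j k := by
      intro i j k x
      have hc := contDiff_cubicForm T
      have e1 : pd k φ = fun y => (1 / 6) * pd k (cubicForm T) y := funext fun y =>
        pd_const_mul hc.contDiffAt.differentiableAt_of_infty _ k
      have e2 : pd j (pd k φ) = fun y => (1 / 6) * pd j (pd k (cubicForm T)) y := by
        rw [e1]
        exact funext fun y =>
          pd_const_mul (contDiff_pd hc k).contDiffAt.differentiableAt_of_infty _ j
      rw [e2, pd_const_mul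
        (contDiff_pd (contDiff_pd hc k) j).contDiffAt.differentiableAt_of_infty,
        pd_pd_pd_cubicForm hT1 hT2]
      ring
    have hl := lhs_jetEq hUo hE hs hφv
    have hd : ∀ i j, DifferentiableAt 𝕜 (pd i (pd j φ)) 0 := fun i j =>
      (contDiff_pd (contDiff_pd hφs j) i).contDiffAt.differentiableAt_of_infty
    have hC := hF (fun y => s + φ y) 0 (contDiffAt_const.add hφs.contDiffAt)
      (by rw [hφv.eq_zero, add_zero]; exact hs)
      (by
        rw [hl.apply_eq]
        simp [fun i j => ((hφv.pd j).pd i).eq_zero])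
      (by
        intro k
        have hd1 : ∀ i j, DifferentiableAt 𝕜 (fun y => E.V s i j * pd i (pd j φ) y) 0 :=
          fun i j => (hd i j).const_mul _
        have hd2 : ∀ i, DifferentiableAt 𝕜 (fun y => ∑ j, E.V s i j * pd i (pd j φ) y) 0 :=
          fun i => DifferentiableAt.fun_sum fun j _ => hd1 i j
        rw [(hl.pd k).apply_eq, pd_sum _ fun i _ => hd2 i]
        simp only [pd_sum _ fun j _ => hd1 _ j, pd_const_mul (hd _ _), hφ3]
        rw [← htr k]
        refine Finset.sum_congr rfl fun i _ => Finset.sum_congr rfl fun j _ => ?_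
        rw [hT1, hT2])
    simp only [cotton_metric_eq_linSchouten hUo hE hs (hV s hs) hφv, pd_linSchouten hφs] at hC
    have := wedge_eq_zero_of_linCotton_eq_zero (α := α) (E.V_symm s) (hinvs s) hHs hWG
      (N := fun r i j => pd r (linRicci (E.V s) H φ i j) 0)
      (fun r i j => pd_linRicci hφs (fun i j k => hφ3 i j k 0) hT1 hT2 (E.V_symm s) htr r i j)
      hC q r
    simpa only [Matrix.mulVec_mulVec] using this
  have hne : E.V s ≠ 0 := by
    intro h0
    apply hV s hs
    rw [h0, Matrix.det_zero]
  obtain ⟨c, hc⟩ := isScalar_of_wedge_eq_zero (E.V_symm s) hne hwedge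
  have h1 := deriv_V_inv hUo hE hs hV
  -- `V' = -V H V`, and `H V` is scalar
  have h2 : (Matrix.of fun i j => deriv (fun σ => E.V σ i j) s) = (-c) • E.V s := by
    have h3 := congrArg (· * E.V s) h1
    simp only [add_mul, Matrix.mul_assoc, Matrix.nonsing_inv_mul _ hu, zero_mul, mul_one] at h3
    rw [← hH, hc, mul_smul_comm, mul_one] at h3
    rw [eq_neg_of_add_eq_zero_left h3, neg_smul]
  exact ⟨-c, fun i j => by simpa using congrFun (congrFun h2 i) j⟩

end Coeffs

/-! ### Conformally flat metrics -/

section ConformallyFlat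

variable {𝕜 : Type*} [RCLike 𝕜] {g : Space 𝕜 → Matrix (Fin 3) (Fin 3) 𝕜}
  {G : Matrix (Fin 3) (Fin 3) 𝕜} {h : Space 𝕜 → 𝕜} {x : Space 𝕜}

/-- The logarithmic derivative `∂_i h / h` of a conformal factor. -/
def logPd (h : Space 𝕜 → 𝕜) (i : Fin 3) (y : Space 𝕜) : 𝕜 := (h y)⁻¹ * pd i h y

/-- The logarithmic gradient `G^{kl} ∂_l h / h` of a conformal factor. -/
def logGrad (G : Matrix (Fin 3) (Fin 3) 𝕜) (h : Space 𝕜 → 𝕜) (k : Fin 3) (y : Space 𝕜) : 𝕜 :=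
  ∑ l, G⁻¹ k l * logPd h l y

theorem contDiffAt_logPd (hh : ContDiffAt 𝕜 ∞ h x) (h0 : h x ≠ 0) (i : Fin 3) :
    ContDiffAt 𝕜 ∞ (logPd h i) x := (hh.inv h0).mul (contDiffAt_pd hh i)

theorem contDiffAt_logGrad (hh : ContDiffAt 𝕜 ∞ h x) (h0 : h x ≠ 0) (k : Fin 3) :
    ContDiffAt 𝕜 ∞ (logGrad G h k) x :=
  ContDiffAt.sum fun l _ => contDiffAt_const.mul (contDiffAt_logPd hh h0 l)

theorem pd_logPd_comm (hh : ContDiffAt 𝕜 ∞ h x) (h0 : h x ≠ 0) (i j : Fin 3) :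
    pd i (logPd h j) =ᶠ[𝓝 x] pd j (logPd h i) := by
  have h1 : ∀ a, (fun y => h y * logPd h a y) =ᶠ[𝓝 x] pd a h := by
    intro a
    filter_upwards [hh.continuousAt.eventually_ne h0] with y hy
    simp [logPd, hy]
  have h2 : ∀ a b, pd a (pd b h) =ᶠ[𝓝 x]
      fun y => pd a h y * logPd h b y + h y * pd a (logPd h b) y := fun a b =>
    (pd_eventuallyEq (h1 b) a).symm.trans (pd_mul_eventually hh (contDiffAt_logPd hh h0 b) a)
  filter_upwards [hh.continuousAt.eventually_ne h0, h2 i j, h2 j i, pd_comm_eventually hh i j]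
    with y hy e1 e2 e3
  rw [e1, e2] at e3
  refine mul_left_cancel₀ hy ?_
  simp only [logPd] at e3 ⊢
  linear_combination e3

/-- The Christoffel symbols of the metric `h G`, in terms of the logarithmic differential `ψ` and
the logarithmic gradient `Ψ` of `h`. -/
def conformalChristoffel (G : Matrix (Fin 3) (Fin 3) 𝕜) (ψ Ψ : Fin 3 → 𝕜) (k i j : Fin 3) : 𝕜 :=
  (1 / 2) * ((1 : Matrix (Fin 3) (Fin 3) 𝕜) k j * ψ i + (1 : Matrix (Fin 3) (Fin 3) 𝕜) k i * ψ j
    - G i j * Ψ k)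

/-- Christoffel symbols of a conformally flat metric `h G`. -/
theorem christoffel_conformal (hGs : ∀ i j, G i j = G j i) (hG : IsUnit G.det)
    (hh : ContDiffAt 𝕜 ∞ h x) (h0 : h x ≠ 0)
    (hg : ∀ᶠ y in 𝓝 x, g y = h y • G) (k i j : Fin 3) :
    christoffel g k i j =ᶠ[𝓝 x] fun y =>
      conformalChristoffel G (fun i => logPd h i y) (fun k => logGrad G h k y) k i j := by
  filter_upwards [hg.eventually_nhds, hh.continuousAt.eventually_ne h0,
    eventually_differentiableAt hh] with y hy hy0 hd
  have h1 : ∀ l i j, pd l (fun y => g y i j) y = pd l h y * G i j := by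
    intro l i j
    have : (fun y => g y i j) =ᶠ[𝓝 y] fun y => G i j * h y := by
      filter_upwards [hy] with z hz
      rw [hz, Matrix.smul_apply, smul_eq_mul, mul_comm]
    rw [pd_congr this, pd_const_mul hd, mul_comm]
  have h2 : (g y)⁻¹ = (h y)⁻¹ • G⁻¹ := by
    rw [hy.self_of_nhds]
    exact Matrix.inv_smul' G (Units.mk0 _ hy0) hG
  have h3 : ∀ i, ∑ l, G⁻¹ k l * G i l = (1 : Matrix (Fin 3) (Fin 3) 𝕜) k i := by
    intro i
    rw [← Matrix.nonsing_inv_mul _ hG, Matrix.mul_apply]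
    exact Finset.sum_congr rfl fun l _ => by rw [hGs i l]
  have h4 : ∀ l, (h y)⁻¹ * pd l h y = logPd h l y := fun l => rfl
  simp only [christoffel, conformalChristoffel, h1, h2, Matrix.smul_apply, smul_eq_mul]
  congr 1
  rw [logGrad, ← h3 i, ← h3 j, Finset.sum_mul, Finset.sum_mul, Finset.mul_sum,
    ← Finset.sum_add_distrib, ← Finset.sum_sub_distrib]
  refine Finset.sum_congr rfl fun l _ => ?_
  rw [← h4, ← h4, ← h4]
  ring

theorem sum_conformalChristoffel_mul (ψ Ψ X : Fin 3 → 𝕜) (i j : Fin 3) :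
    ∑ k, conformalChristoffel G ψ Ψ k i j * X k
      = (1 / 2) * (ψ i * X j + ψ j * X i - G i j * ∑ k, Ψ k * X k) := by
  have h1 : ∀ k, conformalChristoffel G ψ Ψ k i j * X k
      = (1 / 2) * (ψ i * (X k * (1 : Matrix (Fin 3) (Fin 3) 𝕜) k j)
        + ψ j * (X k * (1 : Matrix (Fin 3) (Fin 3) 𝕜) k i) - G i j * (Ψ k * X k)) := by
    intro k; simp only [conformalChristoffel]; ring
  simp only [h1, ← Finset.mul_sum, Finset.sum_add_distrib, Finset.sum_sub_distrib,
    sum_mul_one_apply]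

theorem sum_conformalChristoffel_self (hGs : ∀ i j, G i j = G j i) {ψ Ψ : Fin 3 → 𝕜}
    (hψ : ∀ i, ψ i = ∑ k, G i k * Ψ k) (l : Fin 3) :
    ∑ k, conformalChristoffel G ψ Ψ k k l = (3 / 2) * ψ l := by
  have h1 : ∀ k, conformalChristoffel G ψ Ψ k k l
      = (1 / 2) * (ψ k * (1 : Matrix (Fin 3) (Fin 3) 𝕜) k l + ψ l - G l k * Ψ k) := by
    intro k; simp only [conformalChristoffel, Matrix.one_apply_eq, hGs k l]; ring
  simp only [h1, ← Finset.mul_sum, Finset.sum_add_distrib, Finset.sum_sub_distrib,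
    sum_mul_one_apply, ← hψ, Finset.sum_const, Finset.card_univ, Fintype.card_fin]
  simp only [nsmul_eq_mul]; push_cast; ring

theorem conformalChristoffel_symm (hGs : ∀ i j, G i j = G j i) (ψ Ψ : Fin 3 → 𝕜)
    (k i j : Fin 3) : conformalChristoffel G ψ Ψ k i j = conformalChristoffel G ψ Ψ k j i := by
  simp only [conformalChristoffel, hGs i j]; ring

/-- The quadratic part of the Ricci tensor of a conformally flat metric in dimension three. -/
theorem sum_conformalChristoffel_quadratic (hGs : ∀ i j, G i j = G j i) {ψ Ψ : Fin 3 → 𝕜}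
    (hψ : ∀ i, ψ i = ∑ k, G i k * Ψ k) (i j : Fin 3) :
    ∑ k, ∑ l, (conformalChristoffel G ψ Ψ k k l * conformalChristoffel G ψ Ψ l i j
        - conformalChristoffel G ψ Ψ k j l * conformalChristoffel G ψ Ψ l i k)
      = (1 / 4) * (ψ i * ψ j) - (1 / 4) * (∑ k, Ψ k * ψ k) * G i j := by
  have h1 : ∑ k, ∑ l, conformalChristoffel G ψ Ψ k k l * conformalChristoffel G ψ Ψ l i j
      = (3 / 4) * (2 * (ψ i * ψ j) - G i j * ∑ k, Ψ k * ψ k) := by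
    rw [Finset.sum_comm]
    simp only [← Finset.sum_mul, sum_conformalChristoffel_self hGs hψ]
    have := sum_conformalChristoffel_mul (G := G) ψ Ψ ψ i j
    simp only [mul_assoc, mul_comm (ψ _) (conformalChristoffel _ _ _ _ _ _), ← Finset.mul_sum,
      this]
    ring
  have h2 : ∀ k, ∑ l, G j l * conformalChristoffel G ψ Ψ l i k
      = (1 / 2) * (ψ i * G j k + ψ k * G j i - G i k * ψ j) := by
    intro k
    simp only [mul_comm (G j _)]
    rw [sum_conformalChristoffel_mul, hψ j]
    simp only [mul_comm (Ψ _)]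
  have h3 : ∑ k, Ψ k * ∑ l, G j l * conformalChristoffel G ψ Ψ l i k
      = (1 / 2) * (G i j * ∑ k, Ψ k * ψ k) := by
    have h4 : ∀ k, Ψ k * ∑ l, G j l * conformalChristoffel G ψ Ψ l i k
        = (1 / 2) * (ψ i * (G j k * Ψ k) + G i j * (Ψ k * ψ k) - ψ j * (G i k * Ψ k)) := by
      intro k; rw [h2, hGs j i]; ring
    simp only [h4, ← Finset.mul_sum, Finset.sum_add_distrib, Finset.sum_sub_distrib, ← hψ]
    ring
  have h5 : ∑ k, ∑ l, conformalChristoffel G ψ Ψ k j l * conformalChristoffel G ψ Ψ l i k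
      = (1 / 2) * ((5 / 2) * (ψ i * ψ j) - G i j * ∑ k, Ψ k * ψ k) := by
    rw [Finset.sum_comm]
    simp only [sum_conformalChristoffel_mul ψ Ψ (fun k => conformalChristoffel G ψ Ψ _ i k)]
    have h6 : ∑ l, G j l * ∑ k, Ψ k * conformalChristoffel G ψ Ψ l i k
        = ∑ k, Ψ k * ∑ l, G j l * conformalChristoffel G ψ Ψ l i k := by
      simp only [Finset.mul_sum]
      rw [Finset.sum_comm]
      exact Finset.sum_congr rfl fun _ _ => Finset.sum_congr rfl fun _ _ => by ring
    simp only [← Finset.mul_sum, Finset.sum_add_distrib, Finset.sum_sub_distrib, h6, h3]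
    simp only [conformalChristoffel_symm hGs ψ Ψ _ i _, sum_conformalChristoffel_self hGs hψ]
    have h7 := sum_conformalChristoffel_mul (G := G) ψ Ψ ψ j i
    simp only [mul_comm (ψ _) (conformalChristoffel _ _ _ _ _ _), h7, hGs j i]
    ring
  simp only [Finset.sum_sub_distrib, h1, h5]
  ring

/-- The part of the Ricci tensor of a conformally flat metric that is linear in the second
derivatives: `A` and `B` stand for the first derivatives of the logarithmic differential and of
the logarithmic gradient. -/
theorem sum_conformalChristoffel_linear {A B : Fin 3 → Fin 3 → 𝕜}
    (hA : ∀ i j, A i j = ∑ k, G j k * B i k) (hAs : ∀ i j, A i j = A j i) (i j : Fin 3) :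
    ∑ k, (conformalChristoffel G (A k) (B k) k i j - conformalChristoffel G (A j) (B j) k i k)
      = -(1 / 2) * A j i - (1 / 2) * (∑ k, B k k) * G i j := by
  have h1 : ∀ k, conformalChristoffel G (A k) (B k) k i j
      - conformalChristoffel G (A j) (B j) k i k
      = (1 / 2) * (A i k * (1 : Matrix (Fin 3) (Fin 3) 𝕜) k j
        + A j k * (1 : Matrix (Fin 3) (Fin 3) 𝕜) k i - G i j * B k k
        - A j i - A j k * (1 : Matrix (Fin 3) (Fin 3) 𝕜) k i + G i k * B j k) := by
    intro k
    simp only [conformalChristoffel, Matrix.one_apply_eq, hAs k]; ring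
  simp only [h1, ← Finset.mul_sum, Finset.sum_add_distrib, Finset.sum_sub_distrib,
    sum_mul_one_apply, ← hA, Finset.sum_const, Finset.card_univ, Fintype.card_fin]
  simp only [nsmul_eq_mul]; push_cast
  rw [hAs i j]; ring

theorem sum_mul_logGrad (hG : IsUnit G.det) (i : Fin 3) (y : Space 𝕜) :
    ∑ k, G i k * logGrad G h k y = logPd h i y := by
  have h1 : G.mulVec (G⁻¹.mulVec fun l => logPd h l y) = fun l => logPd h l y := by
    rw [Matrix.mulVec_mulVec, Matrix.mul_nonsing_inv _ hG, Matrix.one_mulVec]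
  exact congrFun h1 i

theorem sum_mul_pd_logGrad (hG : IsUnit G.det) {y : Space 𝕜}
    (hd : ∀ k, DifferentiableAt 𝕜 (logGrad G h k) y) (m i : Fin 3) :
    pd m (logPd h i) y = ∑ k, G i k * pd m (logGrad G h k) y := by
  have h1 : logPd h i = fun y => ∑ k, G i k * logGrad G h k y :=
    funext fun y => (sum_mul_logGrad hG i y).symm
  rw [h1, pd_sum _ fun k _ => (hd k).const_mul _]
  exact Finset.sum_congr rfl fun k _ => pd_const_mul (hd k) _ m

theorem pd_christoffel_conformal (hGs : ∀ i j, G i j = G j i) (hG : IsUnit G.det)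
    (hh : ContDiffAt 𝕜 ∞ h x) (h0 : h x ≠ 0)
    (hg : ∀ᶠ y in 𝓝 x, g y = h y • G) (m k i j : Fin 3) :
    pd m (christoffel g k i j) =ᶠ[𝓝 x] fun y =>
      conformalChristoffel G (fun i => pd m (logPd h i) y) (fun k => pd m (logGrad G h k) y)
        k i j := by
  refine (pd_eventuallyEq (christoffel_conformal hGs hG hh h0 hg k i j) m).trans ?_
  filter_upwards [eventually_all.2 fun i =>
    eventually_differentiableAt (contDiffAt_logPd hh h0 i), eventually_all.2 fun k =>
    eventually_differentiableAt (contDiffAt_logGrad (G := G) hh h0 k)] with y hψ hΨ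
  have e := fun (c : 𝕜) i => (hψ i).const_mul c
  unfold conformalChristoffel
  rw [pd_const_mul (((e _ i).fun_add (e _ j)).fun_sub ((hΨ k).const_mul _)),
    pd_sub ((e _ i).fun_add (e _ j)) ((hΨ k).const_mul _), pd_add (e _ i) (e _ j),
    pd_const_mul (hψ i), pd_const_mul (hψ j), pd_const_mul (hΨ k)]

/-- The Ricci tensor of the conformally flat metric `h G`. -/
theorem ricci_conformal (hGs : ∀ i j, G i j = G j i) (hG : IsUnit G.det)
    (hh : ContDiffAt 𝕜 ∞ h x) (h0 : h x ≠ 0)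
    (hg : ∀ᶠ y in 𝓝 x, g y = h y • G) (i j : Fin 3) :
    ricci g i j =ᶠ[𝓝 x] fun y => -(1 / 2) * pd j (logPd h i) y
      + (1 / 4) * (logPd h i y * logPd h j y) - ((1 / 2) * (∑ k, pd k (logGrad G h k) y)
        + (1 / 4) * ∑ k, logGrad G h k y * logPd h k y) * G i j := by
  filter_upwards [eventually_all.2 fun k => eventually_all.2 fun i => eventually_all.2 fun j =>
      christoffel_conformal hGs hG hh h0 hg k i j,
    eventually_all.2 fun m => eventually_all.2 fun k => eventually_all.2 fun i =>
      eventually_all.2 fun j => pd_christoffel_conformal hGs hG hh h0 hg m k i j,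
    eventually_all.2 fun i => eventually_all.2 fun j => pd_logPd_comm hh h0 i j,
    eventually_all.2 fun k =>
      eventually_differentiableAt (contDiffAt_logGrad (G := G) hh h0 k)] with y h1 h2 h3 h4
  have e1 := sum_conformalChristoffel_quadratic hGs
    (fun i => (sum_mul_logGrad (h := h) hG i y).symm) i j
  have e2 := sum_conformalChristoffel_linear (G := G) (A := fun m i => pd m (logPd h i) y)
    (B := fun m k => pd m (logGrad G h k) y) (fun m i => sum_mul_pd_logGrad hG h4 m i) h3 i j
  simp only [ricci, h1, h2]
  rw [e1, e2]
  ring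

/-- The Schouten tensor of the conformally flat metric `h G`. -/
theorem schouten_conformal (hGs : ∀ i j, G i j = G j i) (hG : IsUnit G.det)
    (hh : ContDiffAt 𝕜 ∞ h x) (h0 : h x ≠ 0)
    (hg : ∀ᶠ y in 𝓝 x, g y = h y • G) (i j : Fin 3) :
    schouten g i j =ᶠ[𝓝 x] fun y => -(1 / 2) * pd j (logPd h i) y
      + (1 / 4) * (logPd h i y * logPd h j y)
      - (1 / 8) * G i j * ∑ k, logGrad G h k y * logPd h k y := by
  filter_upwards [eventually_all.2 fun i => eventually_all.2 fun j =>
      ricci_conformal hGs hG hh h0 hg i j, hh.continuousAt.eventually_ne h0, hg,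
    eventually_all.2 fun k => eventually_differentiableAt (contDiffAt_logPd hh h0 k),
    eventually_all.2 fun i => eventually_all.2 fun j => pd_logPd_comm hh h0 i j]
    with y hR hy hgy hd hcomm
  have hinv : (g y)⁻¹ = (h y)⁻¹ • G⁻¹ := by
    rw [hgy]
    exact Matrix.inv_smul' G (Units.mk0 _ hy) hG
  have e1 : ∑ i, ∑ j, G⁻¹ i j * pd j (logPd h i) y = ∑ k, pd k (logGrad G h k) y := by
    refine Finset.sum_congr rfl fun k _ => ?_
    unfold logGrad
    rw [pd_sum _ fun l _ => (hd l).const_mul _]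
    exact Finset.sum_congr rfl fun l _ => by rw [pd_const_mul (hd l), hcomm]
  have e2 : ∑ i, ∑ j, G⁻¹ i j * (logPd h i y * logPd h j y)
      = ∑ k, logGrad G h k y * logPd h k y := by
    refine Finset.sum_congr rfl fun k _ => ?_
    rw [logGrad, Finset.sum_mul]
    exact Finset.sum_congr rfl fun l _ => by ring
  have e3 : ∑ i, ∑ j, G⁻¹ i j * G i j = 3 := by
    have : ∀ i, ∑ j, G⁻¹ i j * G i j = 1 := by
      intro i
      have h1 := congrFun (congrFun (Matrix.nonsing_inv_mul _ hG) i) i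
      rw [Matrix.mul_apply, Matrix.one_apply_eq] at h1
      rw [← h1]
      exact Finset.sum_congr rfl fun j _ => by rw [hGs i j]
    simp [this]
  have hS : scalarCurvature g y = (h y)⁻¹ * (-2 * (∑ k, pd k (logGrad G h k) y)
      - (1 / 2) * ∑ k, logGrad G h k y * logPd h k y) := by
    have h1 : ∀ i j, (g y)⁻¹ i j * ricci g i j y = (h y)⁻¹ *
        (-(1 / 2) * (G⁻¹ i j * pd j (logPd h i) y)
        + (1 / 4) * (G⁻¹ i j * (logPd h i y * logPd h j y))
        - ((1 / 2) * (∑ k, pd k (logGrad G h k) y)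
          + (1 / 4) * ∑ k, logGrad G h k y * logPd h k y) * (G⁻¹ i j * G i j)) := by
      intro i j
      rw [hinv, hR, Matrix.smul_apply, smul_eq_mul]
      ring
    simp only [scalarCurvature, h1, ← Finset.mul_sum, Finset.sum_add_distrib,
      Finset.sum_sub_distrib, e1, e2, e3]
    ring
  rw [schouten, hS, hR, hgy, Matrix.smul_apply, smul_eq_mul]
  field_simp
  ring

/-- A metric that is conformal to a constant one has vanishing Cotton tensor. -/
theorem cotton_conformal (hGs : ∀ i j, G i j = G j i) (hG : IsUnit G.det)
    (hh : ContDiffAt 𝕜 ∞ h x) (h0 : h x ≠ 0)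
    (hg : ∀ᶠ y in 𝓝 x, g y = h y • G) (p q r : Fin 3) : cotton g p q r x = 0 := by
  have hψ := fun i => contDiffAt_logPd hh h0 i
  have hΨ := fun k => contDiffAt_logGrad (G := G) hh h0 k
  have dψ := fun i => (hψ i).differentiableAt_of_infty
  have dΨ := fun i => (hΨ i).differentiableAt_of_infty
  have dA := fun i j => (contDiffAt_pd (hψ i) j).differentiableAt_of_infty
  have hP := fun i j => schouten_conformal hGs hG hh h0 hg i j
  have hPx : ∀ i j, schouten g i j x = -(1 / 2) * pd j (logPd h i) x
      + (1 / 4) * (logPd h i x * logPd h j x)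
      - (1 / 8) * G i j * ∑ k, logGrad G h k x * logPd h k x := fun i j => (hP i j).self_of_nhds
  have hA : ∀ i j, pd i (logPd h j) x = pd j (logPd h i) x := fun i j =>
    (pd_logPd_comm hh h0 i j).self_of_nhds
  have hlow := fun i => sum_mul_logGrad (h := h) hG i x
  have hN : ∀ r, pd r (fun y => ∑ k, logGrad G h k y * logPd h k y) x
      = 2 * ∑ k, logGrad G h k x * pd r (logPd h k) x := by
    intro r
    rw [pd_sum _ fun k _ => (dΨ k).fun_mul (dψ k)]
    simp only [pd_mul (dΨ _) (dψ _), Finset.sum_add_distrib]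
    have h1 : ∑ k, pd r (logGrad G h k) x * logPd h k x
        = ∑ k, logGrad G h k x * pd r (logPd h k) x := by
      simp only [sum_mul_pd_logGrad hG dΨ, ← hlow, Finset.mul_sum]
      rw [Finset.sum_comm]
      exact Finset.sum_congr rfl fun _ _ => Finset.sum_congr rfl fun _ _ => by
        rw [hGs]; ring
    rw [h1]; ring
  have hdN : DifferentiableAt 𝕜 (fun y => ∑ k, logGrad G h k y * logPd h k y) x :=
    DifferentiableAt.fun_sum fun k _ => (dΨ k).fun_mul (dψ k)
  have hdP : ∀ r i j, pd r (schouten g i j) x = -(1 / 2) * pd r (pd j (logPd h i)) x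
      + (1 / 4) * (pd r (logPd h i) x * logPd h j x + logPd h i x * pd r (logPd h j) x)
      - (1 / 4) * G i j * ∑ k, logGrad G h k x * pd r (logPd h k) x := by
    intro r i j
    rw [pd_congr (hP i j), pd_sub (((dA i j).const_mul _).fun_add
        (((dψ i).fun_mul (dψ j)).const_mul _)) (hdN.const_mul _),
      pd_add ((dA i j).const_mul _) (((dψ i).fun_mul (dψ j)).const_mul _),
      pd_const_mul (dA i j), pd_const_mul ((dψ i).fun_mul (dψ j)), pd_mul (dψ i) (dψ j),
      pd_const_mul hdN, hN]
    ring
  have hΨP : ∀ j, ∑ s, logGrad G h s x * schouten g s j x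
      = -(1 / 2) * (∑ k, logGrad G h k x * pd j (logPd h k) x)
        + (1 / 8) * (∑ k, logGrad G h k x * logPd h k x) * logPd h j x := by
    intro j
    have h1 : ∀ s, logGrad G h s x * schouten g s j x
        = -(1 / 2) * (logGrad G h s x * pd j (logPd h s) x)
          + (1 / 4) * (logPd h j x * (logGrad G h s x * logPd h s x))
          - (1 / 8) * (∑ k, logGrad G h k x * logPd h k x) * (G j s * logGrad G h s x) := by
      intro s
      rw [hPx s j, hGs s j]; ring
    simp only [h1, ← Finset.mul_sum, Finset.sum_add_distrib, Finset.sum_sub_distrib, hlow]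
    ring
  have hPs : ∀ i j, schouten g i j x = schouten g j i x := by
    intro i j
    rw [hPx i j, hPx j i, hA i j, hGs i j]
    ring
  have hΓ := fun k i j => (christoffel_conformal hGs hG hh h0 hg k i j).self_of_nhds
  have hcov : ∀ r i j, covSchouten g r i j x = pd r (schouten g i j) x
      - ((1 / 2) * (logPd h r x * schouten g i j x + logPd h i x * schouten g r j x
          - G r i * ∑ s, logGrad G h s x * schouten g s j x)
        + (1 / 2) * (logPd h r x * schouten g j i x + logPd h j x * schouten g r i x
          - G r j * ∑ s, logGrad G h s x * schouten g s i x)) := by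
    intro r i j
    simp only [covSchouten, hΓ, Finset.sum_add_distrib, hPs i, sum_conformalChristoffel_mul]
  have h3 : pd r (pd q (logPd h p)) x = pd q (pd r (logPd h p)) x :=
    pd_comm (contDiffAt_infty.1 (hψ p) 2) r q
  simp only [cotton, hcov]
  simp only [hΨP]
  simp only [hdP, hPx, h3, hA r q, hA q p, hA r p, hGs r q, hGs q p, hGs r p]
  ring

end ConformallyFlat

/-! ### Proportionality of the values of `V`, and linearizability -/

section Proportional

variable {𝕜 : Type*} [RCLike 𝕜]

/-- Two matrices are proportional: all `2 × 2` minors of the pair vanish. On nonzero matrices this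
is an equivalence relation. -/
def Proportional (M N : Matrix (Fin 3) (Fin 3) 𝕜) : Prop :=
  ∀ i j k l, M i j * N k l = M k l * N i j

variable {M N P : Matrix (Fin 3) (Fin 3) 𝕜}

theorem exists_entry_ne_zero (hN : N ≠ 0) : ∃ k l, N k l ≠ 0 := by
  by_contra! h
  exact hN (Matrix.ext h)

theorem Proportional.symm (h : Proportional M N) : Proportional N M := fun i j k l => by
  linear_combination -h i j k l

theorem Proportional.trans (hN : N ≠ 0) (h1 : Proportional M N) (h2 : Proportional N P) :
    Proportional M P := by
  obtain ⟨a, b, hab⟩ := exists_entry_ne_zero hN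
  intro i j k l
  refine mul_left_cancel₀ (mul_ne_zero hab hab) ?_
  linear_combination N a b * P k l * h1 i j a b - N a b * P i j * h1 k l a b
    + M a b * N i j * h2 a b k l - M a b * N k l * h2 a b i j

/-- A matrix-valued function on a connected set that is locally proportional to its values is
globally a scalar multiple of one constant matrix. -/
theorem exists_eq_smul_of_locally_proportional {U : Set 𝕜} (hUc : IsConnected U)
    {V : 𝕜 → Matrix (Fin 3) (Fin 3) 𝕜} (hV : ∀ s ∈ U, V s ≠ 0)
    (h : ∀ s ∈ U, ∀ᶠ σ in 𝓝[U] s, Proportional (V s) (V σ)) :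
    ∃ (V₀ : Matrix (Fin 3) (Fin 3) 𝕜) (f : 𝕜 → 𝕜), ∀ s ∈ U, V s = f s • V₀ := by
  obtain ⟨s₀, hs₀⟩ := hUc.nonempty
  obtain ⟨k, l, hkl⟩ := exists_entry_ne_zero (hV s₀ hs₀)
  have key : ∀ s ∈ U, Proportional (V s₀) (V s) := by
    intro s hs
    refine hUc.isPreconnected.induction₂ (fun a b => Proportional (V a) (V b)) h
      ?_ ?_ hs₀ hs
    · intro a b c ha hb hc hab hbc
      exact hab.trans (hV b hb) hbc
    · intro a b ha hb hab
      exact hab.symm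
  refine ⟨V s₀, fun s => V s k l / V s₀ k l, fun s hs => ?_⟩
  ext i j
  rw [Matrix.smul_apply, smul_eq_mul, div_mul_eq_mul_div, eq_div_iff hkl]
  linear_combination -key s hs i j k l

end Proportional

namespace Coeffs

variable {𝕜 : Type*} [RCLike 𝕜] {E : Coeffs 𝕜} {U : Set 𝕜}

theorem V_ne_zero {s : 𝕜} (hV : (E.V s).det ≠ 0) : E.V s ≠ 0 := by
  intro h0
  rw [h0, Matrix.det_zero] at hV
  exact hV rfl

theorem ConformallyFlatOnSolutions.exists_eq_smul (hUo : IsOpen U) (hUc : IsConnected U)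
    (hE : E.SmoothOn U) (hV : ∀ s ∈ U, (E.V s).det ≠ 0) (hF : E.ConformallyFlatOnSolutions U) :
    ∃ (V₀ : Matrix (Fin 3) (Fin 3) 𝕜) (f : 𝕜 → 𝕜), ∀ s ∈ U, E.V s = f s • V₀ := by
  refine exists_eq_smul_of_locally_proportional hUc (fun s hs => V_ne_zero (hV s hs)) ?_
  intro s hs
  obtain ⟨k, l, hkl⟩ := exists_entry_ne_zero (V_ne_zero (hV s hs))
  have hne : ∀ᶠ σ in 𝓝 s, E.V σ k l ≠ 0 :=
    (contDiffAt_V hUo hE hs k l).continuousAt.eventually_ne hkl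
  obtain ⟨ε, hε, hball⟩ := Metric.eventually_nhds_iff_ball.1 (hne.and (hUo.mem_nhds hs))
  -- quotients of entries have zero derivative, since `V'` is a multiple of `V`
  have hconst : ∀ i j, ∀ σ ∈ Metric.ball s ε,
      E.V σ i j / E.V σ k l = E.V s i j / E.V s k l := by
    intro i j σ hσ
    have hd : ∀ τ ∈ Metric.ball s ε,
        HasDerivAt (fun τ => E.V τ i j / E.V τ k l) 0 τ := by
      intro τ hτ
      obtain ⟨h0, hτU⟩ := hball τ hτ
      obtain ⟨c, hc⟩ := hF.exists_deriv_V_eq hUo hE hV hτU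
      have hd := fun i j => ((contDiffAt_V hUo hE hτU i j).differentiableAt
        (by simp)).hasDerivAt
      have := (hd i j).fun_div (hd k l) h0
      rw [hc, hc] at this
      rwa [show c * E.V τ i j * E.V τ k l - E.V τ i j * (c * E.V τ k l) = 0 by ring,
        zero_div] at this
    exact (convex_ball s ε).is_const_of_fderivWithin_eq_zero (𝕜 := 𝕜)
      (fun τ hτ => (hd τ hτ).differentiableAt.differentiableWithinAt)
      (fun τ hτ => by
        rw [fderivWithin_of_isOpen Metric.isOpen_ball hτ]
        ext
        simp [(hd τ hτ).deriv]) hσ (Metric.mem_ball_self hε)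
  filter_upwards [mem_nhdsWithin_of_mem_nhds (Metric.ball_mem_nhds s hε)] with σ hσ
  have h0 := (hball σ hσ).1
  have e : ∀ i j, E.V σ i j = E.V s i j / E.V s k l * E.V σ k l := fun i j => by
    rw [← hconst i j σ hσ, div_mul_cancel₀ _ h0]
  intro i j a b
  rw [e a b, e i j]
  ring

theorem conformallyFlat_of_eq_smul (hUo : IsOpen U) (hE : E.SmoothOn U)
    (hV : ∀ s ∈ U, (E.V s).det ≠ 0) {V₀ : Matrix (Fin 3) (Fin 3) 𝕜} {f : 𝕜 → 𝕜}
    (hf : ∀ s ∈ U, E.V s = f s • V₀) : E.ConformallyFlatOnSolutions U := by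
  intro u x hu hux _ _ i j k
  have hV0 : V₀ ≠ 0 := by
    rintro rfl
    exact V_ne_zero (hV _ hux) (by rw [hf _ hux, smul_zero])
  have hf0 : ∀ s ∈ U, f s ≠ 0 := fun s hs h0 =>
    V_ne_zero (hV s hs) (by rw [hf s hs, h0, zero_smul])
  obtain ⟨a, b, hab⟩ := exists_entry_ne_zero hV0
  have hdet : IsUnit V₀.det := by
    refine isUnit_iff_ne_zero.2 fun h0 => hV _ hux ?_
    rw [hf _ hux, Matrix.det_smul, h0, mul_zero]
  have hfe : ∀ s ∈ U, E.V s a b / V₀ a b = f s := fun s hs => by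
    rw [hf s hs, Matrix.smul_apply, smul_eq_mul, mul_div_cancel_right₀ _ hab]
  have hsymm : ∀ i j, V₀ i j = V₀ j i := fun i j => by
    refine mul_left_cancel₀ (hf0 _ hux) ?_
    simpa [hf _ hux] using E.V_symm (u x) i j
  have hnum : ContDiffAt 𝕜 ∞ (fun y => (E.V (u y) a b / V₀ a b)⁻¹) x := by
    refine ContDiffAt.inv (((contDiffAt_V hUo hE hux a b).comp x hu).div_const _) ?_
    exact (hfe _ hux).symm ▸ hf0 _ hux
  refine cotton_conformal (G := V₀⁻¹) (h := fun y => (E.V (u y) a b / V₀ a b)⁻¹)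
    (inv_apply_symm hsymm) ?_
    hnum ?_ ?_ i j k
  · exact Matrix.isUnit_nonsing_inv_det _ hdet
  · rw [hfe _ hux]
    exact inv_ne_zero (hf0 _ hux)
  · filter_upwards [hu.continuousAt.eventually (hUo.mem_nhds hux)] with y hy
    rw [hfe _ hy, metric, hf _ hy]
    exact Matrix.inv_smul' V₀ (Units.mk0 _ (hf0 _ hy)) hdet

theorem linearizable_of_eq_smul (hUo : IsOpen U) (hE : E.SmoothOn U)
    (hV : ∀ s ∈ U, (E.V s).det ≠ 0) {V₀ : Matrix (Fin 3) (Fin 3) 𝕜} {f : 𝕜 → 𝕜}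
    (hf : ∀ s ∈ U, E.V s = f s • V₀) : E.Linearizable U := by
  intro u₀ hu₀
  have hV0 : V₀ ≠ 0 := by
    rintro rfl
    exact V_ne_zero (hV _ hu₀) (by rw [hf _ hu₀, smul_zero])
  have hf0 : ∀ s ∈ U, f s ≠ 0 := fun s hs h0 =>
    V_ne_zero (hV s hs) (by rw [hf s hs, h0, zero_smul])
  obtain ⟨a, b, hab⟩ := exists_entry_ne_zero hV0
  -- an antiderivative of `f`, read off from a coefficient function
  let F : 𝕜 → 𝕜 := fun σ => E.entry a b σ / V₀ a b
  have hFs : ∀ σ ∈ U, ContDiffAt 𝕜 ∞ F σ := fun σ hσ =>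
    (contDiffAt_entry hUo hE hσ a b).div_const _
  have hFd : ∀ σ ∈ U, HasDerivAt F (f σ) σ := by
    intro σ hσ
    have h1 := ((contDiffAt_entry hUo hE hσ a b).differentiableAt (by simp)).hasDerivAt.div_const
      (V₀ a b)
    rwa [deriv_entry, hf σ hσ, Matrix.smul_apply, smul_eq_mul, mul_div_cancel_right₀ _ hab] at h1
  let e₀ : OpenPartialHomeomorph 𝕜 𝕜 := (hFs u₀ hu₀).toOpenPartialHomeomorph F
    ((hFd u₀ hu₀).hasFDerivAt_equiv (hf0 _ hu₀)) (by simp)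
  let e := e₀.restrOpen U hUo
  have hes : e.source ⊆ U := by
    rw [OpenPartialHomeomorph.restrOpen_source]
    exact Set.inter_subset_right
  refine ⟨.refl 𝕜 _, e.symm, ?_, hes, ?_, ?_, fun _ => V₀, 0, 0, 0, ?_⟩
  · change u₀ ∈ e.source
    rw [OpenPartialHomeomorph.restrOpen_source]
    exact ⟨(hFs u₀ hu₀).mem_toOpenPartialHomeomorph_source _ (by simp), hu₀⟩
  · intro y hy
    have hy' : e.symm y ∈ U := hes (e.map_target hy)
    exact (e.contDiffAt_symm_deriv (hf0 _ hy') hy (hFd _ hy') (hFs _ hy')).contDiffWithinAt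
  · intro σ hσ
    exact (hFs σ (hes hσ)).contDiffWithinAt
  · intro w x hw hwx
    change ContDiffAt 𝕜 ∞ w x at hw
    change w x ∈ e.target at hwx
    set u : Space 𝕜 → 𝕜 := fun z => e.symm (w z) with hu
    have huU : ∀ {y}, w y ∈ e.target → u y ∈ U := fun hy => hes (e.map_target hy)
    have hsm : ContDiffAt 𝕜 ∞ e.symm (w x) :=
      e.contDiffAt_symm_deriv (hf0 _ (huU hwx)) hwx (hFd _ (huU hwx)) (hFs _ (huU hwx))
    have hux : ContDiffAt 𝕜 ∞ u x := hsm.comp x hw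
    have hnear : ∀ᶠ y in 𝓝 x, w y ∈ e.target :=
      hw.continuousAt.eventually (e.open_target.mem_nhds hwx)
    have key : ∀ i j, pd j (fun z => E.entry i j (u z)) =ᶠ[𝓝 x] fun y => V₀ i j * pd j w y := by
      intro i j
      filter_upwards [hnear.eventually_nhds, eventually_differentiableAt hux] with y hy hd
      have hyU := huU hy.self_of_nhds
      have h1 : w =ᶠ[𝓝 y] fun z => F (u z) := by
        filter_upwards [hy] with z hz
        exact (e.right_inv hz).symm
      rw [pd_congr h1, pd_comp (hFd _ hyU).differentiableAt hd, (hFd _ hyU).deriv,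
        pd_comp ((contDiffAt_entry hUo hE hyU i j).differentiableAt (by simp)) hd, deriv_entry,
        hf _ hyU, Matrix.smul_apply, smul_eq_mul]
      ring
    have hlhs : E.lhs u x = ∑ i, ∑ j, V₀ i j * pd i (pd j w) x := by
      rw [E.lhs_eq_sum fun i j => contDiffAt_infty.1
        ((contDiffAt_entry hUo hE (huU hwx) i j).comp x hux) 2]
      refine Finset.sum_congr rfl fun i _ => Finset.sum_congr rfl fun j _ => ?_
      rw [pd_congr (key i j), pd_const_mul (contDiffAt_pd hw j).differentiableAt_of_infty]
    change E.lhs u x = 0 ↔ _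
    rw [hlhs]
    simp

/-- Symmetric matrices `M` and `N` are proportional if every symmetric matrix orthogonal to `M` is
orthogonal to `N`. -/
theorem proportional_of_annihilator {M N : Matrix (Fin 3) (Fin 3) 𝕜}
    (hM : ∀ i j, M i j = M j i) (hN : ∀ i j, N i j = N j i)
    (h : ∀ S : Fin 3 → Fin 3 → 𝕜, (∀ i j, S i j = S j i) →
      ∑ i, ∑ j, M i j * S i j = 0 → ∑ i, ∑ j, N i j * S i j = 0) : Proportional M N := by
  intro i j k l
  -- `∑ P_{ab} S₀ i j a b = 2 P_{ij}` for symmetric `P`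
  let S₀ : Fin 3 → Fin 3 → Fin 3 → Fin 3 → 𝕜 := fun i j a b =>
    (if a = i then 1 else 0) * (if b = j then 1 else 0)
      + (if a = j then 1 else 0) * (if b = i then 1 else 0)
  have hS₀ : ∀ i j a b, S₀ i j a b = S₀ i j b a := fun i j a b => by simp only [S₀]; ring
  have hsum : ∀ (P : Matrix (Fin 3) (Fin 3) 𝕜), (∀ i j, P i j = P j i) → ∀ i j,
      ∑ a, ∑ b, P a b * S₀ i j a b = 2 * P i j := by
    intro P hP i j
    simp [S₀, mul_add, Finset.sum_add_distrib, two_mul, hP j i]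
  have hsum' : ∀ (P : Matrix (Fin 3) (Fin 3) 𝕜), (∀ i j, P i j = P j i) →
      ∑ a, ∑ b, P a b * (M k l * S₀ i j a b - M i j * S₀ k l a b)
        = M k l * (2 * P i j) - M i j * (2 * P k l) := by
    intro P hP
    rw [← hsum P hP, ← hsum P hP]
    simp only [Finset.mul_sum, ← Finset.sum_sub_distrib]
    exact Finset.sum_congr rfl fun _ _ => Finset.sum_congr rfl fun _ _ => by ring
  have h1 := h (fun a b => M k l * S₀ i j a b - M i j * S₀ k l a b)
    (fun a b => by rw [hS₀ i j a b, hS₀ k l a b]) (by rw [hsum' M hM]; ring)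
  rw [hsum' N hN] at h1
  linear_combination (-1 / 2) * h1

theorem Linearizable.exists_eq_smul (hUo : IsOpen U) (hUc : IsConnected U)
    (hE : E.SmoothOn U) (hV : ∀ s ∈ U, (E.V s).det ≠ 0) (hL : E.Linearizable U) :
    ∃ (V₀ : Matrix (Fin 3) (Fin 3) 𝕜) (f : 𝕜 → 𝕜), ∀ s ∈ U, E.V s = f s • V₀ := by
  refine exists_eq_smul_of_locally_proportional hUc (fun s hs => V_ne_zero (hV s hs)) ?_
  intro s hs
  obtain ⟨A, φ, hsφ, hφU, hφ, hφs, L, l, l₀, m, H⟩ := hL s hs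
  -- The functions `w = c + S(A⁻¹ y)` have a critical point at `0`; there the linear equation
  -- becomes a condition on `S` in which the value `c` plays no role.
  have key : ∀ τ ∈ φ.target, ∀ S : Fin 3 → Fin 3 → 𝕜, (∀ i j, S i j = S j i) →
      (∑ i, ∑ j, E.V τ i j * S i j = 0 ↔
        (∑ i, ∑ j, L 0 i j * pd i (pd j fun y => quadForm S (A.symm y)) 0)
          + (∑ i, l 0 i * pd i (fun y => quadForm S (A.symm y)) 0) = 0) := by
    intro τ hτ
    set c := φ.symm τ with hc
    have hcs : c ∈ φ.source := φ.map_target hτ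
    have hφc : φ c = τ := φ.right_inv hτ
    have hφd : ContDiffAt 𝕜 ∞ φ c := hφ.contDiffAt (φ.open_source.mem_nhds hcs)
    have hφ0 : deriv φ c ≠ 0 := by
      have h1 : DifferentiableAt 𝕜 φ.symm (φ c) := by
        rw [hφc]
        exact (hφs.contDiffAt (φ.open_target.mem_nhds hτ)).differentiableAt (by simp)
      have h2 := h1.hasDerivAt.comp c (hφd.differentiableAt (by simp)).hasDerivAt
      have h3 : (φ.symm ∘ φ) =ᶠ[𝓝 c] id := by
        filter_upwards [φ.open_source.mem_nhds hcs] with z hz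
        exact φ.left_inv hz
      have h4 := h2.deriv
      rw [h3.deriv_eq, deriv_id] at h4
      intro h0
      simp [h0] at h4
    have hlin : ∀ S : Fin 3 → Fin 3 → 𝕜, (∀ i j, S i j = S j i) →
        (∑ i, ∑ j, E.V τ i j * S i j = 0 ↔
        (∑ i, ∑ j, L 0 i j * pd i (pd j fun y => quadForm S (A.symm y)) 0)
          + (∑ i, l 0 i * pd i (fun y => quadForm S (A.symm y)) 0) + l₀ 0 * c + m 0 = 0) := by
      intro S hS
      have hq : ContDiff 𝕜 ∞ (fun y => quadForm S (A.symm y)) :=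
        (contDiff_quadForm S).comp A.symm.contDiff
      have hq0 : quadForm S 0 = 0 := by simp [quadForm]
      have hpd : ∀ {q : Space 𝕜 → 𝕜}, ContDiff 𝕜 ∞ q → ∀ i, pd i (fun y => c + q y) = pd i q := by
        intro q hq i
        funext y
        rw [pd_add (differentiableAt_const c) hq.contDiffAt.differentiableAt_of_infty, pd_const]
        simp
      have h1 := H (fun y => c + quadForm S (A.symm y)) 0 (contDiff_const.add hq).contDiffAt
        (by simpa [hq0] using hcs)
      simp only [map_zero, ContinuousLinearEquiv.symm_apply_apply, hpd hq, hq0, add_zero] at h1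
      rw [← h1]
      have hF : ∀ i j, ContDiffAt 𝕜 ∞ (fun σ => E.entry i j (φ σ)) (c + quadForm S 0) := by
        intro i j
        rw [hq0, add_zero]
        refine ContDiffAt.comp c ?_ hφd
        rw [hφc]
        exact contDiffAt_entry hUo hE (hφU hτ) i j
      have hu : ContDiffAt 𝕜 ∞ (fun z => c + quadForm S z) 0 :=
        (contDiff_const.add (contDiff_quadForm S)).contDiffAt
      have hder : ∀ i j, deriv (fun σ => E.entry i j (φ σ)) c = E.V τ i j * deriv φ c := by
        intro i j
        have h2 := (contDiffAt_entry hUo hE (hφU hτ) i j).differentiableAt (by simp)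
        rw [← hφc] at h2
        have h3 := h2.hasDerivAt.comp c (hφd.differentiableAt (by simp)).hasDerivAt
        have h4 := h3.deriv
        rw [hφc, deriv_entry] at h4
        exact h4
      have hlhs : E.lhs (fun z => φ (c + quadForm S z)) 0
          = 2 * deriv φ c * ∑ i, ∑ j, E.V τ i j * S i j := by
        have hFu : ∀ i j, ContDiffAt 𝕜 2 (fun z => E.entry i j (φ (c + quadForm S z))) 0 :=
          fun i j => contDiffAt_infty.1
            (ContDiffAt.comp (g := fun σ => E.entry i j (φ σ)) 0 (hF i j) hu) 2
        rw [E.lhs_eq_sum hFu]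
        simp only [Finset.mul_sum]
        refine Finset.sum_congr rfl fun i _ => Finset.sum_congr rfl fun j _ => ?_
        rw [pd_pd_comp_of_critical (F := fun σ => E.entry i j (φ σ)) (hF i j) hu,
          hpd (contDiff_quadForm S), pd_pd_quadForm hS, hq0, add_zero, hder, hS j i]
        · ring
        · intro k
          rw [hpd (contDiff_quadForm S), pd_quadForm hS]
          simp
      rw [hlhs]
      simp [hφ0]
    -- the constant function `w = c` makes the left-hand side vanish
    have h0 : l₀ 0 * c + m 0 = 0 := by
      have h1 := (hlin 0 (fun _ _ => rfl)).1 (by simp)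
      have h2 : (fun y => quadForm (0 : Fin 3 → Fin 3 → 𝕜) (A.symm y)) = fun _ => 0 := by
        funext y; simp [quadForm]
      simpa [h2, pd_const] using h1
    intro S hS
    rw [hlin S hS, add_assoc, h0, add_zero]
  filter_upwards [mem_nhdsWithin_of_mem_nhds (φ.open_target.mem_nhds hsφ)] with σ hσ
  exact proportional_of_annihilator (E.V_symm s) (E.V_symm σ) fun S hS h =>
    (key σ hσ S hS).2 ((key s hsφ S hS).1 h)

theorem exists_V_eq_of_eq_smul (hUo : IsOpen U) (hUc : IsConnected U)
    (hc : ∀ s ∈ U, E.c s = s) {V₀ : Matrix (Fin 3) (Fin 3) 𝕜} {f : 𝕜 → 𝕜}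
    (hf : ∀ s ∈ U, E.V s = f s • V₀) : ∃ V₀ : Matrix (Fin 3) (Fin 3) 𝕜, ∀ s ∈ U, E.V s = V₀ := by
  obtain ⟨s₀, hs₀⟩ := hUc.nonempty
  have h1 : ∀ s ∈ U, f s * V₀ 2 2 = 1 := by
    intro s hs
    have h2 : E.V s 2 2 = 1 := by
      have h3 : E.c =ᶠ[𝓝 s] id := by
        filter_upwards [hUo.mem_nhds hs] with σ hσ using hc σ hσ
      change deriv E.c s = 1
      rw [h3.deriv_eq, deriv_id]
    rw [← h2, hf s hs, Matrix.smul_apply, smul_eq_mul]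
  refine ⟨E.V s₀, fun s hs => ?_⟩
  have h0 : V₀ 2 2 ≠ 0 := right_ne_zero_of_mul_eq_one (h1 s hs)
  rw [hf s hs, hf s₀ hs₀, mul_right_cancel₀ h0 ((h1 s hs).trans (h1 s₀ hs₀).symm)]

end Coeffs

end TypeIEquation

end

theorem theorem2 {𝕜 : Type*} [RCLike 𝕜] (E : TypeIEquation.Coeffs 𝕜) (U : Set 𝕜)
    (hUo : IsOpen U) (hUc : IsConnected U) (hE : E.SmoothOn U)
    (hV : ∀ s ∈ U, (E.V s).det ≠ 0) :
    (E.Linearizable U ↔ E.ConformallyFlatOnSolutions U) ∧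
    (E.ConformallyFlatOnSolutions U ↔
      ∃ (V₀ : Matrix (Fin 3) (Fin 3) 𝕜) (f : 𝕜 → 𝕜), ∀ s ∈ U, E.V s = f s • V₀) ∧
    ((∀ s ∈ U, E.c s = s) →
      (E.ConformallyFlatOnSolutions U ↔
        ∃ V₀ : Matrix (Fin 3) (Fin 3) 𝕜, ∀ s ∈ U, E.V s = V₀)) := by
  have h1 : E.ConformallyFlatOnSolutions U ↔
      ∃ (V₀ : Matrix (Fin 3) (Fin 3) 𝕜) (f : 𝕜 → 𝕜), ∀ s ∈ U, E.V s = f s • V₀ :=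
    ⟨fun h => h.exists_eq_smul hUo hUc hE hV,
      fun ⟨_, _, hf⟩ => TypeIEquation.Coeffs.conformallyFlat_of_eq_smul hUo hE hV hf⟩
  refine ⟨?_, h1, fun hc => ?_⟩
  · rw [h1]
    exact ⟨fun h => h.exists_eq_smul hUo hUc hE hV,
      fun ⟨_, _, hf⟩ => TypeIEquation.Coeffs.linearizable_of_eq_smul hUo hE hV hf⟩
  · rw [h1]
    refine ⟨fun ⟨_, _, hf⟩ => TypeIEquation.Coeffs.exists_V_eq_of_eq_smul hUo hUc hc hf,
      fun ⟨V₀, h⟩ => ⟨V₀, fun _ => 1, fun s hs => ?_⟩⟩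
    rw [h s hs, one_smul]
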